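/- Let $\Gamma$ be a finite simple graph with totally ordered vertex set $V$ such that (i) $\Gamma$ has no induced $4$-cycle, (ii) $\Gamma$ is not complete, and (iii) no (possibly empty) clique $K$ of $\Gamma$ separates $\Gamma$, i.e. $\Gamma\setminus K$ is connected for every clique $K$. Let $W_\Gamma=\langle V\mid a^2=1\ (a\in V),\ ab=ba\ (\{a,b\}\text{ an edge of }\Gamma)\rangle$ be the associated right-angled Coxeter group, with the word metric $d$ with respect to $V$. Let $a_i\neq a_j$ be non-adjacent vertices of $\Gamma$, let $\gamma=(a_ia_j)^\infty$ be the geodesic ray whose $n$-th vertex $\gamma(n)$ is the product of the first $n$ letters of $a_ia_ja_ia_j\cdots$, and let $b_\gamma(w)=\lim_{n\to\infty}\bigl(d(\gamma(n),w)-d(\gamma(n),e)\bigr)$ be its Busemann function. Let $k$ be an integer. The $2$-Rips graph on the horosphere $b_\gamma^{-1}(k)$ has vertex set $b_\gamma^{-1}(k)$, and two distinct vertices $w,v$ are joined by an edge exactly when $d(w,v)\le 2$. Every $w\in W_\Gamma$ is written in prefix–suffix form: as a pair $(p,s)$ of words in $V$ such that $ps$ is a geodesic word for $w$, $p$ consists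 of letters $a_i,a_j$ only, and $s$ is a shortlex word that does not represent the same element as any geodesic word beginning with $a_i$ or $a_j$. Then there is an algorithm (depending on $\Gamma,a_i,a_j,k$) which, given $n\in\mathbb N$, outputs $n$ distinct vertices of the $2$-Rips graph on $b_\gamma^{-1}(k)$, together with a list of exactly the edges of the $2$-Rips graph between these $n$ vertices, and whose running time is $O(n\log n)$ as $n\to\infty$. The vertices are output letter by letter in prefix–suffix form (and the edges as pairs of such vertices), and they are taken in order of the length of the suffix: if a vertex with suffix of length $\ell$ is output, then so are all vertices of $b_\gamma^{-1}(k)$ with suffix of length less than $\ell$. Here an algorithm is a Turing machine with finitely many stacks (equivalently, a multitape Turing machine), $n$ is given in unary, and running time is the number of steps of the machine. -/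

import Mathlib

open Filter Topology Asymptotics

namespace RACG

section Group

variable {V : Type}

/-- The standing assumptions on the defining graph: it has no induced squares, it is not complete,
and no (possibly empty) clique `K` separates it. -/
structure StandingAssumptions (Γ : SimpleGraph V) : Prop where
  no_induced_square : ¬ (SimpleGraph.cycleGraph 4).IsIndContained Γ
  not_complete : Γ ≠ ⊤
  no_separating_clique : ∀ K : Set V, Γ.IsClique K → (Γ.induce Kᶜ).Preconnected

open Classical in
/-- The right-angled Coxeter matrix of a graph: `m(a, a) = 1`, `m(a, b) = 2` if `a` and `b` are
adjacent, and `m(a, b) = ∞` (which Mathlib writes as `0`) if they are distinct and not adjacent. -/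
noncomputable def coxeterMatrix (Γ : SimpleGraph V) : CoxeterMatrix V where
  M := Matrix.of fun a b => if a = b then 1 else if Γ.Adj a b then 2 else 0
  isSymm := by
    ext a b
    simp only [Matrix.transpose_apply, Matrix.of_apply, eq_comm (a := b), Γ.adj_comm b]
  diagonal a := by simp
  off_diagonal a b h := by
    simp only [Matrix.of_apply, if_neg h]
    split_ifs <;> norm_num

/-- The right-angled Coxeter group `W_Γ`, generated by the vertices of `Γ` with the relations
`a² = 1` for every vertex `a` and `(ab)² = 1` (that is, `ab = ba`) for every edge `{a, b}`. -/
abbrev Grp (Γ : SimpleGraph V) : Type := (coxeterMatrix Γ).Group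

/-- `W_Γ` with its standard generating set `V`. -/
noncomputable abbrev system (Γ : SimpleGraph V) : CoxeterSystem (coxeterMatrix Γ) (Grp Γ) :=
  (coxeterMatrix Γ).toCoxeterSystem

/-- The element of `W_Γ` that a word in the vertices represents. -/
noncomputable abbrev eval (Γ : SimpleGraph V) (w : List V) : Grp Γ := (system Γ).wordProd w

/-- A word is geodesic if no word for the same element is shorter. -/
abbrev IsGeodesic (Γ : SimpleGraph V) (w : List V) : Prop := (system Γ).IsReduced w

/-- The word metric `d(g, h) = |g⁻¹ h|` of the Cayley graph of `W_Γ` with respect to `V`. -/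
noncomputable def wordDist (Γ : SimpleGraph V) (g h : Grp Γ) : ℕ := (system Γ).length (g⁻¹ * h)

/-- The `n`-th vertex of the ray `(ab)^∞`, the product of the first `n` letters of `a b a b …`. -/
noncomputable def ray (Γ : SimpleGraph V) (a b : V) (n : ℕ) : Grp Γ :=
  eval Γ ((List.range n).map fun t => if Even t then a else b)

/-- The `k`-horosphere about `γ = (ab)^∞`: the level set `b_γ⁻¹(k)` of the Busemann function
`b_γ(w) = lim_n (d(γ(n), w) - d(γ(n), e))`. -/
def horosphere (Γ : SimpleGraph V) (a b : V) (k : ℤ) : Set (Grp Γ) :=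
  {w | Tendsto (fun n : ℕ => (wordDist Γ (ray Γ a b n) w : ℤ) - (wordDist Γ (ray Γ a b n) 1 : ℤ))
    atTop (𝓝 k)}

/-- The `r`-Rips graph on a subset of `W_Γ` with the word metric: distinct points are joined
exactly when their distance is at most `r`. -/
def ripsGraph (Γ : SimpleGraph V) (r : ℕ) (X : Set (Grp Γ)) : SimpleGraph X where
  Adj x y := x ≠ y ∧ wordDist Γ x y ≤ r
  symm := ⟨by
    rintro x y ⟨hne, hd⟩
    refine ⟨hne.symm, ?_⟩
    rw [wordDist, ← (system Γ).length_inv] at hd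
    simpa [wordDist] using hd⟩
  loopless := ⟨fun _ h => h.1 rfl⟩

/-- A word is shortlex if it precedes every other word for the same element in the shortlex
order (shorter words first, words of equal length alphabetically). -/
def IsShortlex [LinearOrder V] (Γ : SimpleGraph V) (w : List V) : Prop :=
  ∀ u : List V, eval Γ u = eval Γ w → u = w ∨ List.Shortlex (· < ·) w u

/-- The pair `(p, s)` is a prefix–suffix decomposition (of the element `ps`) with respect to the
letters `a` and `b`: the word `ps` is geodesic, `p` consists of letters `a` and `b`, and `s` is
shortlex and is not equal to any geodesic word beginning with `a` or `b`. -/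
structure IsPrefixSuffix [LinearOrder V] (Γ : SimpleGraph V) (a b : V) (x : List V × List V) :
    Prop where
  geodesic : IsGeodesic Γ (x.1 ++ x.2)
  prefix_letters : ∀ c ∈ x.1, c = a ∨ c = b
  suffix_shortlex : IsShortlex Γ x.2
  suffix_start : ∀ (c : V) (u : List V), c = a ∨ c = b → IsGeodesic Γ (c :: u) →
    eval Γ (c :: u) ≠ eval Γ x.2

/-- The element that a pair (prefix, suffix) represents. -/
noncomputable abbrev evalPair (Γ : SimpleGraph V) (x : List V × List V) : Grp Γ :=
  eval Γ (x.1 ++ x.2)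

end Group

section Listing

/-- A vertex label is a pair (prefix, suffix) of words. -/
abbrev Label (V : Type) : Type := List V × List V

/-- A finite graph as an algorithm outputs it: a list of vertex labels and a list of edges, each
edge being given by the labels of its endpoints. -/
structure Listing (V : Type) : Type where
  verts : List (Label V)
  edges : List (Label V × Label V)

/-- `G` lists `n` vertices of the `2`-Rips graph on the horosphere `b_γ⁻¹(k)`, `γ = (ab)^∞`, and
all edges between them. The vertices are pairwise distinct, they are written in prefix–suffix
form, and they are taken in order of suffix length: with any vertex, every vertex of the
horosphere with a shorter suffix is listed as well. -/
structure IsRipsListing {V : Type} [LinearOrder V] (Γ : SimpleGraph V) (a b : V) (k : ℤ) (n : ℕ)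
    (G : Listing V) : Prop where
  card : G.verts.length = n
  distinct : (G.verts.map (evalPair Γ)).Nodup
  normal_form : ∀ x ∈ G.verts, IsPrefixSuffix Γ a b x
  on_horosphere : ∀ x ∈ G.verts, evalPair Γ x ∈ horosphere Γ a b k
  exhaustive : ∀ x ∈ G.verts, ∀ y, IsPrefixSuffix Γ a b y → evalPair Γ y ∈ horosphere Γ a b k →
    y.2.length < x.2.length → y ∈ G.verts
  edges_between : ∀ e ∈ G.edges, e.1 ∈ G.verts ∧ e.2 ∈ G.verts
  edges_iff : ∀ x ∈ G.verts, ∀ y ∈ G.verts, ((x, y) ∈ G.edges ∨ (y, x) ∈ G.edges) ↔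
    ∃ (hx : evalPair Γ x ∈ horosphere Γ a b k) (hy : evalPair Γ y ∈ horosphere Γ a b k),
      (ripsGraph Γ 2 (horosphere Γ a b k)).Adj ⟨evalPair Γ x, hx⟩ ⟨evalPair Γ y, hy⟩

/-- The output alphabet: the letters of the group and four punctuation marks. -/
inductive Symbol (V : Type) : Type
  | letter (a : V)
  | dot
  | comma
  | vertex
  | edge

/-- A label `(p, s)` is written letter by letter as `p . s`. -/
def encodeLabel {V : Type} (x : Label V) : List (Symbol V) :=
  x.1.map Symbol.letter ++ Symbol.dot :: x.2.map Symbol.letter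

/-- The output string: for each vertex the mark `vertex` and its label, then for each edge the
mark `edge` and the labels of its two endpoints, separated by a comma. -/
def encodeListing {V : Type} (G : Listing V) : List (Symbol V) :=
  (G.verts.flatMap fun x => Symbol.vertex :: encodeLabel x) ++
    G.edges.flatMap fun e =>
      Symbol.edge :: (encodeLabel e.1 ++ Symbol.comma :: encodeLabel e.2)

end Listing

end RACG

/-!
# Enumeration of a horosphere of a right-angled Coxeter group

Every element of `W_Γ` has exactly one normal form `p s`, where `p` is an alternating word in `a`
and `b` and `s` is a suffix word: a word accepted by the automaton which keeps track of the set
`forb` of letters that may not follow. Right multiplication by a letter is the explicit operation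
`act` on normal forms. The maps `act c` satisfy the defining relations of `W_Γ` (`act_act_self`,
`act_comm`), so that the group acts on the set of normal forms, whence uniqueness (`elt_injective`);
it follows that the normal forms are the prefix–suffix forms (`Good.isPrefixSuffix`,
`IsPrefixSuffix.exists_eq_label`). If `p` has the signed length `t`, positive for words that begin
with `a`, then the Busemann function is `|s| - t` (`elt_mem_horosphere`). Hence a horosphere is
parametrized by the suffix words: `p` is determined by `|s|`. Two of its points are adjacent in the
`2`-Rips graph if and only if they differ by right multiplication by two letters
(`wordDist_le_two_iff`), since one letter always changes the value of the Busemann function.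

The machine runs through the suffix words by depth-first search with increasing depth, which lists
them in shortlex order. For each word it writes the vertex, and then, for each of the finitely many
pairs of letters, it multiplies a copy of the vertex by both letters in place and writes an edge if
the result lies on the same horosphere and its suffix is smaller in the shortlex order. These are
exactly the neighbours listed before (`mem_edgesOf`), so that an edge of the listed graph is written
at that one of its endpoints which is listed later. One vertex costs time linear in the length of
its suffix (`reach_leaf`), and the search of one level costs a constant for each node in addition
(`reach_subtree`), of which there are at most `n`.

It remains to see that the lengths of the suffixes are `O(log n)`, that is, that the number of
suffix words grows exponentially (`two_pow_le_leaves_nil`). Here the assumptions on the graph enter: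
they provide a third vertex `c` that is not adjacent to, say, `a` (`exists_not_adj`), and in words
in which every second letter is `a` the other letters can be chosen freely from `b` and `c`.
-/

namespace RACG

/-! ### Multiplication of normal forms by a letter -/

section NormalForm

variable {V : Type} [LinearOrder V] (Γ : SimpleGraph V) [DecidableRel Γ.Adj]
  (a b : V)

/-- Right multiplication by the letter `c` in terms of prefix–suffix forms. The pair `(t, r)` stands
for the product of the alternating word in `a` and `b` of signed length `t` (see `altWord`) and the
word `r.reverse`. The letter `c` travels to the left through the letters commuting with it. If it
meets a `c`, both cancel; if it is `a` or `b` and arrives at the prefix, it changes the signed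
length of the prefix by one; otherwise it is inserted at the alphabetically best position. -/
def act (c : V) (t : ℤ) : List V → ℤ × List V
  | [] => if c = a then (if Even t then t + 1 else t - 1, [])
      else if c = b then (if Even t then t - 1 else t + 1, []) else (t, [c])
  | x :: r => if x = c then (t, r) else if Γ.Adj x c then
      if (act c t r).2 = c :: r ∧ x < c then ((act c t r).1, c :: x :: r)
        else ((act c t r).1, x :: (act c t r).2)
      else (t, c :: x :: r)

variable {Γ a b}

theorem act_self (c : V) (t : ℤ) (r : List V) : act Γ a b c t (c :: r) = (t, r) := by
  simp [act]

theorem act_of_not_adj {x c : V} (hx : x ≠ c) (h : ¬ Γ.Adj x c) (t : ℤ) (r : List V) :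
    act Γ a b c t (x :: r) = (t, c :: x :: r) := by
  simp [act, hx, h]

theorem act_fst_of_snd_eq {c : V} {t : ℤ} {r : List V} (h : (act Γ a b c t r).2 = c :: r) :
    (act Γ a b c t r).1 = t := by
  cases r with
  | nil => simp only [act] at h ⊢; split_ifs at h ⊢; simp_all
  | cons x r => simp only [act] at h ⊢; split_ifs at h ⊢ <;> simp_all [act_fst_of_snd_eq]

/-- The letter moves to the left of `x` and comes to rest on the right of everything else; since
`x < c`, it has to stay on the right of `x`, too. -/
theorem act_top {x c : V} {t : ℤ} {r : List V} (h : Γ.Adj x c)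
    (h2 : (act Γ a b c t r).2 = c :: r) (h3 : x < c) :
    act Γ a b c t (x :: r) = (t, c :: x :: r) := by
  simp [act, h.ne, h, h2, h3, act_fst_of_snd_eq h2]

/-- The letter moves to the left of `x` and has its effect there. -/
theorem act_deep {x c : V} {t : ℤ} {r : List V} (h : Γ.Adj x c)
    (h2 : ¬ ((act Γ a b c t r).2 = c :: r ∧ x < c)) :
    act Γ a b c t (x :: r) = ((act Γ a b c t r).1, x :: (act Γ a b c t r).2) := by
  simp [act, h.ne, h, h2]

variable [Fintype V]

variable (Γ) in
/-- The transition function of the automaton that reads the suffix words: if `F` is the set of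
letters which may not follow a word `s`, then `nextForb Γ F c` is the set of letters which may not
follow `s c`. -/
def nextForb (F : Finset V) (c : V) : Finset V :=
  {d | d = c ∨ Γ.Adj d c ∧ (d ∈ F ∨ d < c)}

variable (Γ a b) in
/-- The set of letters which may not follow the word `r.reverse` in a suffix word. Words are stored
with the last letter first throughout. -/
def forb : List V → Finset V
  | [] => {a, b}
  | c :: r => nextForb Γ (forb r) c

variable (Γ a b) in
/-- `Good Γ a b r` says that `r.reverse` is accepted by the automaton of suffix words: it is the
suffix in the prefix–suffix form of some group element. -/
def Good : List V → Prop
  | [] => True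
  | c :: r => c ∉ forb Γ a b r ∧ Good r

theorem mem_nextForb {F : Finset V} {c d : V} :
    d ∈ nextForb Γ F c ↔ d = c ∨ Γ.Adj d c ∧ (d ∈ F ∨ d < c) := by
  simp [nextForb]

theorem mem_forb_cons {r : List V} {c d : V} :
    d ∈ forb Γ a b (c :: r) ↔ d = c ∨ Γ.Adj d c ∧ (d ∈ forb Γ a b r ∨ d < c) := by
  rw [forb, mem_nextForb]

/-- A letter that may follow a word is simply appended. -/
theorem act_of_not_mem {c : V} {t : ℤ} {r : List V} (h : c ∉ forb Γ a b r) :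
    act Γ a b c t r = (t, c :: r) := by
  induction r with
  | nil => simp [forb] at h; simp [act, h]
  | cons x r ih =>
    rw [mem_forb_cons] at h
    push Not at h
    by_cases hx : Γ.Adj x c
    · have h2 := h.2 hx.symm
      exact act_top hx (by rw [ih h2.1]) (lt_of_le_of_ne h2.2 hx.ne)
    · exact act_of_not_adj (Ne.symm h.1) hx _ _

/-- Multiplication by a letter `c` that commutes with `x` forbids `x` only in the case that `c` is
appended and greater than `x`. -/
theorem mem_forb_act {x c : V} {t : ℤ} {r : List V} (hx : Γ.Adj x c)
    (h : x ∈ forb Γ a b (act Γ a b c t r).2) :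
    x ∈ forb Γ a b r ∨ (x < c ∧ (act Γ a b c t r).2 = c :: r) := by
  induction r with
  | nil =>
    simp only [act] at h ⊢
    split_ifs at h ⊢ <;> simp_all [mem_forb_cons, hx.ne, or_comm]
  | cons y r ih =>
    by_cases hy : y = c
    · subst hy
      rw [act_self] at h
      exact .inl (mem_forb_cons.2 (.inr ⟨hx, .inl h⟩))
    by_cases hyc : Γ.Adj y c
    · by_cases hA : (act Γ a b c t r).2 = c :: r ∧ y < c
      · rw [act_top hyc hA.1 hA.2] at h ⊢
        simpa [mem_forb_cons (c := c), hx.ne, hx, or_comm] using h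
      · rw [act_deep hyc hA] at h ⊢
        left
        rw [mem_forb_cons] at h ⊢
        rcases h with h | ⟨h1, h | h⟩
        · exact .inl h
        · rcases ih h with h | ⟨h2, h3⟩
          · exact .inr ⟨h1, .inl h⟩
          · refine .inr ⟨h1, .inr (lt_of_lt_of_le h2 ?_)⟩
            by_contra hlt
            exact hA ⟨h3, not_le.1 hlt⟩
        · exact .inr ⟨h1, .inr h⟩
    · rw [act_of_not_adj hy hyc] at h ⊢
      simpa [mem_forb_cons (c := c), hx.ne, hx, or_comm] using h

/-- Multiplication by a letter leads from normal forms to normal forms. -/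
theorem good_act {c : V} {t : ℤ} {r : List V} (hr : Good Γ a b r) :
    Good Γ a b (act Γ a b c t r).2 := by
  induction r with
  | nil => simp only [act]; split_ifs <;> simp_all [Good, forb]
  | cons x r ih =>
    by_cases hx : x = c
    · subst hx; rw [act_self]; exact hr.2
    by_cases hxc : Γ.Adj x c
    · have h := ih hr.2
      by_cases hA : (act Γ a b c t r).2 = c :: r ∧ x < c
      · rw [act_top hxc hA.1 hA.2]
        rw [hA.1] at h
        refine ⟨?_, hr⟩
        rw [mem_forb_cons]
        push Not
        exact ⟨Ne.symm hx, fun _ => ⟨h.1, hA.2.le⟩⟩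
      · rw [act_deep hxc hA]
        refine ⟨fun hm => ?_, h⟩
        rcases mem_forb_act hxc hm with h1 | h1
        · exact hr.1 h1
        · exact hA ⟨h1.2, h1.1⟩
    · rw [act_of_not_adj hx hxc]
      refine ⟨?_, hr⟩
      rw [mem_forb_cons]
      push Not
      exact ⟨Ne.symm hx, fun h => absurd h.symm hxc⟩

/-- The relation `c² = 1` for the action on normal forms. -/
theorem act_act_self (hab : a ≠ b) {c : V} {t : ℤ} {r : List V} (hr : Good Γ a b r) :
    act Γ a b c (act Γ a b c t r).1 (act Γ a b c t r).2 = (t, r) := by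
  induction r with
  | nil =>
    by_cases h1 : c = a
    · by_cases h : Even t <;> simp [act, h1, h, parity_simps]
    · by_cases h2 : c = b
      · by_cases h : Even t <;> simp [act, h2, hab.symm, h, parity_simps]
      · simp [act, h1, h2]
  | cons x r ih =>
    by_cases hx : x = c
    · subst hx; rw [act_self, act_of_not_mem hr.1]
    by_cases hxc : Γ.Adj x c
    · by_cases hA : (act Γ a b c t r).2 = c :: r ∧ x < c
      · rw [act_top hxc hA.1 hA.2, act_self]
      · rw [act_deep hxc hA]
        have ih := ih hr.2
        dsimp only
        rw [act_deep hxc, ih]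
        rw [ih]
        rintro ⟨h1, h2⟩
        dsimp only at h1
        apply hr.1
        rw [h1, mem_forb_cons]
        exact .inr ⟨hxc, .inr h2⟩
    · rw [act_of_not_adj hx hxc, act_self]

/-- The relation `cd = dc` of an edge for the action on normal forms. -/
theorem act_comm (hab : a ≠ b) (hadj : ¬ Γ.Adj a b) {c d : V} (hcd : Γ.Adj c d) {t : ℤ}
    {r : List V} (hr : Good Γ a b r) :
    act Γ a b d (act Γ a b c t r).1 (act Γ a b c t r).2 =
      act Γ a b c (act Γ a b d t r).1 (act Γ a b d t r).2 := by
  have hne := hcd.ne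
  induction r with
  | nil =>
    have hba : ¬ Γ.Adj b a := fun h => hadj h.symm
    have hdc := hcd.symm
    simp only [act]
    split_ifs <;> simp_all [act] <;> grind
  | cons x r ih =>
    have ih := ih hr.2
    by_cases hxc : x = c
    · subst hxc
      rw [act_self]
      by_cases hA : (act Γ a b d t r).2 = d :: r ∧ x < d
      · rw [act_top hcd hA.1 hA.2]
        dsimp only
        have hlen : ∀ p q, r ≠ p :: q :: r := fun p q h => by
          have := congrArg List.length h
          simp at this
          omega
        rw [act_deep hcd.symm (by rw [act_self]; exact fun h => hlen _ _ h.1)]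
        simp [act_self, Prod.ext_iff, hA.1, act_fst_of_snd_eq hA.1]
      · rw [act_deep hcd hA, act_self]
    by_cases hxd : x = d
    · subst hxd
      rw [act_self]
      by_cases hA : (act Γ a b c t r).2 = c :: r ∧ x < c
      · rw [act_top hcd.symm hA.1 hA.2]
        dsimp only
        have hlen : ∀ p q, r ≠ p :: q :: r := fun p q h => by
          have := congrArg List.length h
          simp at this
          omega
        rw [act_deep hcd (by rw [act_self]; exact fun h => hlen _ _ h.1)]
        simp [act_self, Prod.ext_iff, hA.1, act_fst_of_snd_eq hA.1]
      · rw [act_deep hcd.symm hA, act_self]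
    -- if both are appended, they are sorted in the same way
    have top2 : ∀ {c d : V}, Γ.Adj c d → ∀ s : List V,
        act Γ a b c t s = (t, c :: s) → act Γ a b d t s = (t, d :: s) →
        act Γ a b d t (c :: s) = act Γ a b c t (d :: s) := by
      intro c d hcd s h1 h2
      rcases lt_trichotomy c d with h | h | h
      · rw [act_top hcd (by rw [h2]) h, act_deep hcd.symm (by simp [h.le]), h1]
      · exact absurd h hcd.ne
      · rw [act_top hcd.symm (by rw [h1]) h, act_deep hcd (by simp [h.le]), h2]
    -- if `c` is appended to `x :: r` and `d` is not
    have mixed : ∀ {c d : V}, Γ.Adj c d → x ≠ d → Γ.Adj x d → act Γ a b c t (x :: r) =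
        (t, c :: x :: r) → ¬ ((act Γ a b d t r).2 = d :: r ∧ x < d) →
        (act Γ a b c (act Γ a b d t r).1 (x :: (act Γ a b d t r).2)
          = ((act Γ a b d t r).1, c :: x :: (act Γ a b d t r).2)) →
        act Γ a b d (act Γ a b c t (x :: r)).1 (act Γ a b c t (x :: r)).2 =
        act Γ a b c (act Γ a b d t (x :: r)).1 (act Γ a b d t (x :: r)).2 := by
      intro c d hcd hxd hxd' h1 hA h2
      rw [h1, act_deep hxd' hA, h2]
      dsimp only
      rw [act_deep hcd, act_deep hxd' hA]
      rw [act_deep hxd' hA]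
      simp [hxd]
    -- if neither is appended to `x :: r` (one direction of the final comparison)
    have deep : ∀ {c d : V}, Γ.Adj c d → Γ.Adj x c → Γ.Adj x d →
        ¬ ((act Γ a b d t r).2 = d :: r ∧ x < d) →
        act Γ a b d (act Γ a b c t r).1 (act Γ a b c t r).2 =
          act Γ a b c (act Γ a b d t r).1 (act Γ a b d t r).2 →
        ¬ ((act Γ a b d (act Γ a b c t r).1 (act Γ a b c t r).2).2 =
          d :: (act Γ a b c t r).2 ∧ x < d) := by
      rintro c d hcd hxc hxd hA ih ⟨h1, h2⟩
      have e1 : act Γ a b c (act Γ a b c t r).1 (act Γ a b c t r).2 = (t, r) :=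
        act_act_self hab hr.2
      have e2 := act_act_self hab (c := c) (t := (act Γ a b d t r).1)
        (good_act (c := d) (t := t) hr.2)
      rw [← ih] at e2
      rw [h1] at e2
      have e3 : (act Γ a b d (act Γ a b c t r).1 (act Γ a b c t r).2).1 = (act Γ a b c t r).1 :=
        act_fst_of_snd_eq h1
      rw [e3] at e2
      by_cases hB : (act Γ a b c (act Γ a b c t r).1 (act Γ a b c t r).2).2 =
          c :: (act Γ a b c t r).2 ∧ d < c
      · rw [e1] at hB
        dsimp only at hB
        apply hr.1
        rw [hB.1, mem_forb_cons]
        exact .inr ⟨hxc, .inr (h2.trans hB.2)⟩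
      · rw [act_deep hcd.symm hB, e1] at e2
        exact hA ⟨(congrArg Prod.snd e2).symm, h2⟩
    by_cases axc : Γ.Adj x c <;> by_cases axd : Γ.Adj x d
    · by_cases hA : (act Γ a b c t r).2 = c :: r ∧ x < c <;>
        by_cases hB : (act Γ a b d t r).2 = d :: r ∧ x < d
      · rw [act_top axc hA.1 hA.2, act_top axd hB.1 hB.2]
        exact top2 hcd _ (act_top axc hA.1 hA.2) (act_top axd hB.1 hB.2)
      · refine mixed hcd hxd axd (act_top axc hA.1 hA.2) hB ?_
        refine act_top axc ?_ hA.2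
        rw [← ih, hA.1, act_fst_of_snd_eq hA.1]
        rw [act_deep hcd]
        exact fun h => hB ⟨h.1, hA.2.trans h.2⟩
      · refine (mixed hcd.symm hxc axc (act_top axd hB.1 hB.2) hA ?_).symm
        refine act_top axd ?_ hB.2
        rw [ih, hB.1, act_fst_of_snd_eq hB.1]
        rw [act_deep hcd.symm]
        exact fun h => hA ⟨h.1, hB.2.trans h.2⟩
      · rw [act_deep axc hA, act_deep axd hB]
        dsimp only
        rw [act_deep axd (deep hcd axc axd hB ih),
          act_deep axc (deep hcd.symm axd axc hA ih.symm), ih]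
    · have h1 := act_of_not_adj (a := a) (b := b) hxd axd t r
      by_cases hA : (act Γ a b c t r).2 = c :: r ∧ x < c
      · rw [act_top axc hA.1 hA.2, h1]
        exact top2 hcd _ (act_top axc hA.1 hA.2) h1
      · exact (mixed hcd.symm hxc axc h1 hA (act_of_not_adj hxd axd _ _)).symm
    · have h1 := act_of_not_adj (a := a) (b := b) hxc axc t r
      by_cases hB : (act Γ a b d t r).2 = d :: r ∧ x < d
      · rw [act_top axd hB.1 hB.2, h1]
        exact top2 hcd _ h1 (act_top axd hB.1 hB.2)
      · exact mixed hcd hxd axd h1 hB (act_of_not_adj hxc axc _ _)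
    · have h1 := act_of_not_adj (a := a) (b := b) hxc axc t r
      have h2 := act_of_not_adj (a := a) (b := b) hxd axd t r
      rw [h1, h2]
      exact top2 hcd _ h1 h2

end NormalForm

/-! ### Alternating words -/

section Alternating

variable {V : Type}

/-- The alternating word `a b a b …` of length `n`, reversed. -/
def altNat (a b : V) : ℕ → List V
  | 0 => []
  | n + 1 => (if Even n then a else b) :: altNat a b n

/-- The reduced word in `a` and `b` of signed length `t`, reversed: for `t ≥ 0` it is the initial
segment of length `t` of `a b a b …`, for `t ≤ 0` the initial segment of length `-t` of
`b a b a …`. -/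
def altWord (a b : V) (t : ℤ) : List V :=
  if 0 ≤ t then altNat a b t.toNat else altNat b a (-t).toNat

/-- The letter by which the alternating words of signed lengths `t` and `t + 1` differ. -/
def altLetter (a b : V) (t : ℤ) : V := if Even t then a else b

/-- Right multiplication by the letter `c` of a reversed word in `a` and `b`: cancel the last letter
if it is `c`, append `c` otherwise. -/
def mulTop [DecidableEq V] (c : V) : List V → List V
  | [] => [c]
  | x :: p => if x = c then p else c :: x :: p

variable {a b : V}

theorem length_altNat (n : ℕ) : (altNat a b n).length = n := by
  induction n with
  | zero => rfl
  | succ n ih => simp [altNat, ih]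

theorem length_altWord (t : ℤ) : (altWord a b t).length = t.natAbs := by
  unfold altWord
  split_ifs <;> rw [length_altNat] <;> omega

theorem mem_altNat {n : ℕ} {c : V} (h : c ∈ altNat a b n) : c = a ∨ c = b := by
  induction n with
  | zero => simp [altNat] at h
  | succ n ih =>
    simp only [altNat, List.mem_cons] at h
    rcases h with h | h
    · split_ifs at h <;> simp [h]
    · exact ih h

theorem mem_altWord {t : ℤ} {c : V} (h : c ∈ altWord a b t) : c = a ∨ c = b := by
  unfold altWord at h
  split_ifs at h
  · exact mem_altNat h
  · exact (mem_altNat h).symm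

theorem altWord_natCast (n : ℕ) : altWord a b n = altNat a b n := by
  simp [altWord]

theorem altWord_neg_natCast (n : ℕ) : altWord a b (-n) = altNat b a n := by
  cases n with
  | zero => rfl
  | succ n => rw [altWord, if_neg (by push_cast; omega)]; simp

variable [LinearOrder V]

theorem mulTop_altNat_push (hab : a ≠ b) (n : ℕ) :
    mulTop (if Even n then a else b) (altNat a b n) = altNat a b (n + 1) := by
  cases n with
  | zero => simp [altNat, mulTop]
  | succ n =>
    by_cases h : Even n <;> simp [altNat, mulTop, h, hab, hab.symm, parity_simps]

theorem mulTop_altNat_pop (n : ℕ) :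
    mulTop (if Even n then a else b) (altNat a b (n + 1)) = altNat a b n := by
  simp [altNat, mulTop]

theorem mulTop_altWord_succ (hab : a ≠ b) (t : ℤ) :
    mulTop (altLetter a b t) (altWord a b t) = altWord a b (t + 1) := by
  rcases Int.eq_nat_or_neg t with ⟨n, rfl | rfl⟩
  · have h := mulTop_altNat_push hab n
    rw [altWord_natCast]
    simpa [altLetter, ← altWord_natCast] using h
  · cases n with
    | zero => simp [altLetter, altWord, altNat, mulTop]
    | succ n =>
      rw [altWord_neg_natCast]
      have : (-((n + 1 : ℕ) : ℤ) + 1) = -(n : ℤ) := by push_cast; ring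
      rw [this, altWord_neg_natCast, ← mulTop_altNat_pop n]
      congr 1
      by_cases h : Even n <;> simp [altLetter, h, parity_simps]

theorem mulTop_altWord_pred (hab : a ≠ b) (t : ℤ) :
    mulTop (altLetter a b t) (altWord a b (t + 1)) = altWord a b t := by
  rcases Int.eq_nat_or_neg t with ⟨n, rfl | rfl⟩
  · have h := mulTop_altNat_pop (a := a) (b := b) n
    rw [altWord_natCast]
    simpa [altLetter, ← altWord_natCast] using h
  · cases n with
    | zero => simp [altLetter, altWord, altNat, mulTop]
    | succ n =>
      rw [altWord_neg_natCast]
      have : (-((n + 1 : ℕ) : ℤ) + 1) = -(n : ℤ) := by push_cast; ring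
      rw [this, altWord_neg_natCast, ← mulTop_altNat_push hab.symm n]
      congr 1
      by_cases h : Even n <;> simp [altLetter, h, parity_simps]

variable (Γ : SimpleGraph V) [DecidableRel Γ.Adj]

/-- The change of the signed length in `act` is multiplication of the alternating word. -/
theorem mulTop_altWord (hab : a ≠ b) {c : V} (hc : c = a ∨ c = b) (t : ℤ) :
    mulTop c (altWord a b t) = altWord a b (act Γ a b c t []).1 := by
  have h1 := mulTop_altWord_succ hab t
  have h2 := mulTop_altWord_pred hab (t - 1)
  rw [sub_add_cancel] at h2
  rcases hc with rfl | rfl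
  · by_cases h : Even t
    · rw [altLetter, if_pos h] at h1
      simp [act, h, h1]
    · rw [altLetter, if_pos (Int.even_sub_one.2 h)] at h2
      simp only [act, h, h2, if_true, if_false]
  · by_cases h : Even t
    · rw [altLetter, if_neg (by rw [Int.even_sub_one]; simpa using h)] at h2
      simp [act, h, h2, hab.symm]
    · rw [altLetter, if_neg h] at h1
      simp only [act, h, h1, hab.symm, if_true, if_false]

end Alternating

/-! ### The effect of a letter on length and Busemann function -/

section Steps

variable {V : Type} [LinearOrder V] {Γ : SimpleGraph V} [DecidableRel Γ.Adj] {a b : V}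

/-- The three effects of right multiplication by a letter: insertion into the suffix, cancellation
in the suffix, and change of the prefix. In the first case the result is at most as large as the
word with the letter appended. -/
theorem act_cases (c : V) (t : ℤ) (r : List V) :
    ((act Γ a b c t r).1 = t ∧ (act Γ a b c t r).2.length = r.length + 1 ∧
      ((act Γ a b c t r).2 = c :: r ∨ ∃ p z r1 r2, (act Γ a b c t r).2.reverse = p ++ c :: r1 ∧
        r.reverse = p ++ z :: r2 ∧ c < z)) ∨
    ((act Γ a b c t r).1 = t ∧ (act Γ a b c t r).2.length + 1 = r.length) ∨
    ((act Γ a b c t r).2 = r ∧ ((act Γ a b c t r).1 = t + 1 ∨ (act Γ a b c t r).1 = t - 1)) := by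
  induction r with
  | nil =>
    simp only [act]
    split_ifs <;> simp
  | cons x r ih =>
    by_cases hx : x = c
    · subst hx; simp [act_self]
    by_cases hxc : Γ.Adj x c
    · by_cases hA : (act Γ a b c t r).2 = c :: r ∧ x < c
      · rw [act_top hxc hA.1 hA.2]; simp
      · rw [act_deep hxc hA]
        rcases ih with ⟨h1, h2, h3⟩ | ⟨h1, h2⟩ | ⟨h1, h2⟩
        · left
          refine ⟨h1, by simp [h2], .inr ?_⟩
          rcases h3 with h3 | ⟨p, z, r1, r2, e1, e2, hz⟩
          · refine ⟨r.reverse, x, [x], [], by simp [h3], by simp, ?_⟩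
            exact lt_of_le_of_ne (not_lt.1 fun h => hA ⟨h3, h⟩) (Ne.symm hx)
          · exact ⟨p, z, r1 ++ [x], r2 ++ [x], by simp [e1], by simp [e2], hz⟩
        · right; left; simp [h1, h2]
        · right; right; simp [h1, h2]
    · rw [act_of_not_adj hx hxc]; simp

/-- A generator changes the value of the Busemann function by one. -/
theorem busemann_act (c : V) (t : ℤ) (r : List V) :
    ((act Γ a b c t r).2.length : ℤ) - (act Γ a b c t r).1 = r.length - t + 1 ∨
    ((act Γ a b c t r).2.length : ℤ) - (act Γ a b c t r).1 = r.length - t - 1 := by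
  rcases act_cases (Γ := Γ) (a := a) (b := b) c t r with ⟨h1, h2, -⟩ | ⟨h1, h2⟩ | ⟨h1, h2⟩
  · rw [h1, h2]; push_cast; omega
  · rw [h1, ← h2]; push_cast; omega
  · rw [h1]; omega

theorem size_act (c : V) (t : ℤ) (r : List V) :
    (act Γ a b c t r).2.length ≤ r.length + 1 ∧
      (act Γ a b c t r).1.natAbs ≤ t.natAbs + 1 := by
  rcases act_cases (Γ := Γ) (a := a) (b := b) c t r with ⟨h1, h2, -⟩ | ⟨h1, h2⟩ | ⟨h1, h2⟩
  · rw [h1]; omega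
  · rw [h1]; omega
  · rw [h1]; omega

end Steps

/-! ### Existence and uniqueness of normal forms -/

section Element

variable {V : Type} (Γ : SimpleGraph V)

theorem simple_comm {c d : V} (h : Γ.Adj c d) :
    (system Γ).simple c * (system Γ).simple d = (system Γ).simple d * (system Γ).simple c := by
  have h1 := (system Γ).simple_mul_simple_pow c d
  have h2 : (coxeterMatrix Γ) c d = 2 := by
    simp [coxeterMatrix, h.ne, h]
  rw [h2, pow_two] at h1
  have h3 := eq_inv_of_mul_eq_one_left h1
  rwa [mul_inv_rev, (system Γ).inv_simple, (system Γ).inv_simple] at h3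

variable (a b : V)

/-- The label of the pair `(t, r)`: its prefix is the alternating word of signed length `t`, its
suffix the word `r.reverse`. -/
def label (t : ℤ) (r : List V) : Label V := ((altWord a b t).reverse, r.reverse)

/-- The group element represented by the pair `(t, r)`. -/
noncomputable def elt (t : ℤ) (r : List V) : Grp Γ := evalPair Γ (label a b t r)

variable {Γ a b}

theorem elt_cons (t : ℤ) (x : V) (r : List V) :
    elt Γ a b t (x :: r) = elt Γ a b t r * (system Γ).simple x := by
  simp [elt, label, evalPair, CoxeterSystem.wordProd_append, mul_assoc]

theorem elt_zero (r : List V) : elt Γ a b 0 r = eval Γ r.reverse := by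
  simp [elt, label, evalPair, altWord, altNat]

theorem elt_nil (t : ℤ) : elt Γ a b t [] = eval Γ (altWord a b t).reverse := by
  rw [elt, evalPair, label, List.reverse_nil, List.append_nil]

theorem eval_append (u v : List V) : eval Γ (u ++ v) = eval Γ u * eval Γ v :=
  (system Γ).wordProd_append u v

variable [LinearOrder V]

theorem eval_mulTop (c : V) (p : List V) :
    eval Γ (mulTop c p).reverse = eval Γ p.reverse * (system Γ).simple c := by
  cases p with
  | nil => simp [mulTop]
  | cons x p =>
    by_cases h : x = c
    · subst h
      have := (system Γ).simple_mul_simple_cancel_right (w := eval Γ p.reverse) x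
      simpa [mulTop, CoxeterSystem.wordProd_append] using this.symm
    · simp [mulTop, h, CoxeterSystem.wordProd_append, CoxeterSystem.wordProd_cons, mul_assoc]

theorem elt_add_one (hab : a ≠ b) (t : ℤ) :
    elt Γ a b (t + 1) [] = elt Γ a b t [] * (system Γ).simple (altLetter a b t) := by
  rw [elt_nil, ← mulTop_altWord_succ hab, eval_mulTop, elt_nil]

variable [DecidableRel Γ.Adj]

/-- The pair `act c (t, r)` represents the product of the element of `(t, r)` with `c`. -/
theorem elt_mul_simple (hab : a ≠ b) (c : V) (t : ℤ) (r : List V) :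
    elt Γ a b t r * (system Γ).simple c = elt Γ a b (act Γ a b c t r).1 (act Γ a b c t r).2 := by
  induction r with
  | nil =>
    by_cases h : c = a ∨ c = b
    · have h2 : (act Γ a b c t []).2 = [] := by
        simp only [act]; split_ifs <;> simp_all
      rw [h2, elt_nil, elt_nil, ← mulTop_altWord Γ hab h, eval_mulTop]
    · push Not at h
      simp [act, h.1, h.2, elt_cons]
  | cons x r ih =>
    by_cases hx : x = c
    · subst hx
      rw [act_self, elt_cons, CoxeterSystem.simple_mul_simple_cancel_right]
    by_cases hxc : Γ.Adj x c
    · by_cases hA : (act Γ a b c t r).2 = c :: r ∧ x < c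
      · rw [act_top hxc hA.1 hA.2, elt_cons _ c]
      · rw [act_deep hxc hA, elt_cons, elt_cons, ← ih, mul_assoc, mul_assoc, simple_comm Γ hxc]
    · rw [act_of_not_adj hx hxc, elt_cons _ c]

variable [Fintype V]

/-- Every word has a normal form, which is at most as long. If the word is as long as its normal
form, then it is not smaller than its normal form, and its normal form has a non-empty prefix if it
begins with `a` or `b`. -/
theorem exists_normalForm (hab : a ≠ b) (u : List V) :
    ∃ t r, Good Γ a b r ∧ eval Γ u = elt Γ a b t r ∧ t.natAbs + r.length ≤ u.length ∧
      (t.natAbs + r.length = u.length →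
        (t = 0 → r.reverse = u ∨ List.Lex (· < ·) r.reverse u) ∧
        (∀ c u', u = c :: u' → c = a ∨ c = b → t ≠ 0)) := by
  induction u using List.reverseRecOn with
  | nil => exact ⟨0, [], trivial, by simp [elt_zero], by simp, by simp⟩
  | append_singleton u c ih =>
    obtain ⟨t, r, hr, he, hle, heq⟩ := ih
    refine ⟨(act Γ a b c t r).1, (act Γ a b c t r).2, good_act hr, ?_, ?_, ?_⟩
    · rw [← elt_mul_simple hab, ← he, eval_append]
      exact congrArg _ ((system Γ).wordProd_singleton c)
    · rw [List.length_append, List.length_singleton]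
      rcases act_cases (Γ := Γ) (a := a) (b := b) c t r with ⟨h1, h2, -⟩ | ⟨h1, h2⟩ | ⟨h1, h2⟩
      · rw [h1]; omega
      · rw [h1]; omega
      · rw [h1]; omega
    · rw [List.length_append, List.length_singleton]
      intro h
      rcases act_cases (Γ := Γ) (a := a) (b := b) c t r with ⟨h1, h2, h3⟩ | ⟨h1, h2⟩ | ⟨h1, h2⟩
      · rw [h1] at h ⊢
        obtain ⟨g1, g2⟩ := heq (by omega)
        constructor
        · intro ht
          rcases h3 with h3 | ⟨p, z, r1, r2, e1, e2, hz⟩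
          · rw [h3, List.reverse_cons]
            rcases g1 ht with g | g
            · exact .inl (by rw [g])
            -- words of equal length remain in lexicographic order if a letter is appended
            · right
              have hlen : r.reverse.length = u.length := by
                rw [List.length_reverse]; omega
              clear * - g hlen
              generalize r.reverse = l at g hlen
              induction g with
              | nil => simp at hlen
              | cons _ ih => exact .cons (ih (by simpa using hlen))
              | rel h => exact .rel h
          · right
            rw [e1]
            rcases g1 ht with g | g
            · rw [← g, e2, List.append_assoc]
              exact List.Lex.append_left _ (.rel hz) _
            · rw [e2] at g
              have hlen : (p ++ z :: r2).length = u.length := by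
                rw [← e2, List.length_reverse]; omega
              clear * - g hlen hz
              induction p generalizing u with
              | nil =>
                cases g with
                | cons _ => exact .rel hz
                | rel h => exact .rel (hz.trans h)
              | cons y p ih =>
                cases g with
                | cons h => exact .cons (ih _ h (by simpa using hlen))
                | rel h => exact .rel h
        · intro d u' hu hd
          cases u with
          | nil =>
            simp only [List.nil_append, List.cons.injEq] at hu
            obtain ⟨rfl, -⟩ := hu
            obtain rfl : r = [] := by
              simp at hle; simpa using hle.2
            simp only [act] at h2
            split_ifs at h2 <;> simp_all
          | cons e u =>
            simp only [List.cons_append, List.cons.injEq] at hu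
            exact g2 d u (by rw [hu.1]) hd
      · rw [h1] at h; omega
      · rw [h1] at h ⊢
        obtain ⟨g1, g2⟩ := heq (by omega)
        exact ⟨fun ht => by omega, fun _ _ _ _ => by omega⟩

theorem exists_elt (hab : a ≠ b) (w : Grp Γ) : ∃ t r, Good Γ a b r ∧ w = elt Γ a b t r := by
  obtain ⟨u, rfl⟩ := (system Γ).wordProd_surjective w
  obtain ⟨t, r, hr, h, -⟩ := exists_normalForm (Γ := Γ) hab u
  exact ⟨t, r, hr, h⟩

/-- Uniqueness of normal forms: the maps `act c` satisfy the relations of the group, which therefore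
acts on the set of normal forms; the normal form of `w` is the image of the empty one under
`w⁻¹`. -/
theorem elt_injective (hab : a ≠ b) (hadj : ¬ Γ.Adj a b) {t t' : ℤ} {r r' : List V}
    (hr : Good Γ a b r) (hr' : Good Γ a b r') (h : elt Γ a b t r = elt Γ a b t' r') :
    t = t' ∧ r = r' := by
  let X := {x : ℤ × List V // Good Γ a b x.2}
  let f : V → Function.End X := fun c x => ⟨act Γ a b c x.1.1 x.1.2, good_act x.2⟩
  have hf2 : ∀ c, f c * f c = 1 := fun c => by
    funext x; exact Subtype.ext (act_act_self hab x.2)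
  have hf : (coxeterMatrix Γ).IsLiftable f := by
    intro c d
    by_cases hcd : c = d
    · subst hcd
      rw [(coxeterMatrix Γ).diagonal, pow_one, hf2]
    · by_cases hadj' : Γ.Adj c d
      · have h2 : (coxeterMatrix Γ) c d = 2 := by simp [coxeterMatrix, hcd, hadj']
        have h3 : f c * f d = f d * f c := by
          funext x; exact Subtype.ext (act_comm hab hadj hadj' x.2).symm
        rw [h2, pow_two]
        nth_rewrite 2 [h3]
        rw [mul_assoc, ← mul_assoc (f d), hf2, one_mul, hf2]
      · have h2 : (coxeterMatrix Γ) c d = 0 := by simp [coxeterMatrix, hcd, hadj']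
        rw [h2, pow_zero]
  let φ : Grp Γ →* Function.End X := (system Γ).lift ⟨f, hf⟩
  have hφ : ∀ c, φ ((system Γ).simple c) = f c := fun c =>
    (system Γ).lift_apply_simple hf c
  let o : X := ⟨(0, []), trivial⟩
  have hmul : ∀ w c, φ (w * (system Γ).simple c)⁻¹ o = f c (φ w⁻¹ o) := by
    intro w c
    rw [mul_inv_rev, (system Γ).inv_simple, map_mul, hφ]
    rfl
  -- the prefixes are obtained from the empty word letter by letter, in both directions
  have halt : ∀ t : ℤ, (φ (elt Γ a b t [])⁻¹ o).1 = (t, []) := by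
    have hstep := elt_add_one (Γ := Γ) hab
    have hact : ∀ t : ℤ, act Γ a b (altLetter a b t) t [] = (t + 1, []) := by
      intro t
      by_cases ht : Even t <;> simp [act, altLetter, ht, hab.symm]
    have hact' : ∀ t : ℤ, act Γ a b (altLetter a b t) (t + 1) [] = (t, []) := by
      intro t
      by_cases ht : Even t <;> simp [act, altLetter, ht, hab.symm, parity_simps]
    intro t
    induction t using Int.induction_on with
    | zero => rw [elt_zero]; simp; rfl
    | succ n ih =>
      rw [hstep, hmul]
      change act Γ a b _ (φ (elt Γ a b n [])⁻¹ o).1.1 (φ (elt Γ a b n [])⁻¹ o).1.2 = _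
      rw [ih, hact]
    | pred n ih =>
      have h1 := hstep (-n - 1)
      rw [sub_add_cancel] at h1
      have h2 : elt Γ a b (-n - 1) [] = elt Γ a b (-n) [] *
          (system Γ).simple (altLetter a b (-n - 1)) := by
        rw [h1, CoxeterSystem.simple_mul_simple_cancel_right]
      rw [h2, hmul]
      change act Γ a b _ (φ (elt Γ a b (-n) [])⁻¹ o).1.1 (φ (elt Γ a b (-n) [])⁻¹ o).1.2 = _
      rw [ih]
      have := hact' (-n - 1)
      rwa [sub_add_cancel] at this
  -- the letters of the suffix are then appended one by one
  have main : ∀ t r, Good Γ a b r → (φ (elt Γ a b t r)⁻¹ o).1 = (t, r) := by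
    intro t r hr
    induction r with
    | nil => exact halt t
    | cons x r ih =>
      rw [elt_cons, hmul]
      change act Γ a b _ (φ (elt Γ a b t r)⁻¹ o).1.1 (φ (elt Γ a b t r)⁻¹ o).1.2 = _
      rw [ih hr.2, act_of_not_mem hr.1]
  have e := main t r hr
  rw [h, main t' r' hr'] at e
  exact ⟨(congrArg Prod.fst e).symm, (congrArg Prod.snd e).symm⟩

/-- Normal forms are geodesic. -/
theorem length_elt (hab : a ≠ b) (hadj : ¬ Γ.Adj a b) {t : ℤ} {r : List V} (hr : Good Γ a b r) :
    (system Γ).length (elt Γ a b t r) = t.natAbs + r.length := by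
  apply le_antisymm
  · have := (system Γ).length_wordProd_le ((label a b t r).1 ++ (label a b t r).2)
    simpa [label, elt, length_altWord] using this
  · obtain ⟨u, hu, he⟩ := (system Γ).exists_isReduced (elt Γ a b t r)
    obtain ⟨t', r', hr', h1, h2, -⟩ := exists_normalForm (Γ := Γ) hab u
    change _ = eval Γ u at he
    rw [h1] at he
    obtain ⟨rfl, rfl⟩ := elt_injective hab hadj hr hr' he
    rw [← h1, hu.eq]
    exact h2

end Element

/-! ### Normal forms are prefix–suffix forms -/

section PrefixSuffix

variable {V : Type} [LinearOrder V] {Γ : SimpleGraph V} [DecidableRel Γ.Adj] {a b : V}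

/-- The geodesic words in `a` and `b` are the alternating ones. -/
theorem exists_eq_altWord_reverse (hab : a ≠ b) (q : List V) (hq : ∀ c ∈ q, c = a ∨ c = b)
    (hred : IsGeodesic Γ q.reverse) : ∃ t, q = altWord a b t := by
  induction q with
  | nil => exact ⟨0, rfl⟩
  | cons c q ih =>
    have h1 : IsGeodesic Γ q.reverse := by
      have := hred.take q.length
      simpa using this
    obtain ⟨t, ht⟩ := ih (fun d hd => hq d (List.mem_cons_of_mem _ hd)) h1
    refine ⟨(act Γ a b c t []).1, ?_⟩
    rw [← mulTop_altWord Γ hab (hq c List.mem_cons_self), ← ht]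
    cases q with
    | nil => rfl
    | cons x q =>
      by_cases hx : x = c
      · subst hx
        exfalso
        have h2 : eval Γ (x :: x :: q).reverse = eval Γ q.reverse := by
          have := eval_mulTop (Γ := Γ) x (x :: q)
          simp only [mulTop, if_true] at this
          rw [this]
          simp [CoxeterSystem.wordProd_append, CoxeterSystem.wordProd_cons, mul_assoc]
        have h3 := hred.eq
        change (system Γ).length (eval Γ _) = _ at h3
        rw [h2] at h3
        have h4 : (system Γ).length (eval Γ q.reverse) ≤ _ :=
          (system Γ).length_wordProd_le q.reverse
        simp only [List.length_reverse, List.length_cons] at h3 h4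
        omega
      · simp [mulTop, hx]

variable [Fintype V]

theorem Good.isShortlex (hab : a ≠ b) (hadj : ¬ Γ.Adj a b) {r : List V} (hr : Good Γ a b r) :
    IsShortlex Γ r.reverse := by
  intro u hu
  obtain ⟨t', r', hr', h1, h2, h3⟩ := exists_normalForm (Γ := Γ) hab u
  rw [hu, ← elt_zero (a := a) (b := b)] at h1
  obtain ⟨rfl, rfl⟩ := elt_injective hab hadj hr hr' h1
  rcases h2.lt_or_eq with h | h
  · right
    exact List.Shortlex.of_length_lt (by simpa using h)
  · rcases (h3 h).1 rfl with g | g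
    · exact .inl g.symm
    · right
      exact List.Shortlex.of_lex (by simpa using h) g

theorem Good.isPrefixSuffix (hab : a ≠ b) (hadj : ¬ Γ.Adj a b) (t : ℤ) {r : List V}
    (hr : Good Γ a b r) : IsPrefixSuffix Γ a b (label a b t r) where
  geodesic := by
    have := length_elt hab hadj (t := t) hr
    simpa [IsGeodesic, CoxeterSystem.IsReduced, label, length_altWord, elt] using this
  prefix_letters c hc := mem_altWord (List.mem_reverse.1 hc)
  suffix_shortlex := hr.isShortlex hab hadj
  suffix_start c u hc hu he := by
    obtain ⟨t', r', hr', h1, h2, h3⟩ := exists_normalForm (Γ := Γ) hab (c :: u)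
    have hl := length_elt hab hadj (t := t') hr'
    rw [← h1, hu.eq] at hl
    have ht' := (h3 hl.symm).2 c u rfl hc
    change eval Γ (c :: u) = eval Γ r.reverse at he
    rw [h1, ← elt_zero (a := a) (b := b)] at he
    exact ht' (elt_injective hab hadj hr' hr he).1

/-- There are no other prefix–suffix forms than the normal forms; in particular, the
prefix–suffix form of an element is unique. -/
theorem IsPrefixSuffix.exists_eq_label (hab : a ≠ b) (hadj : ¬ Γ.Adj a b) {y : Label V}
    (hy : IsPrefixSuffix Γ a b y) : ∃ t r, Good Γ a b r ∧ y = label a b t r := by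
  obtain ⟨p, s⟩ := y
  have hp : IsGeodesic Γ p := by
    have := hy.geodesic.take p.length
    simpa using this
  obtain ⟨t, ht⟩ := exists_eq_altWord_reverse hab p.reverse
    (fun c hc => hy.prefix_letters c (List.mem_reverse.1 hc)) (by simpa using hp)
  obtain ⟨t', r, hr, he⟩ := exists_elt hab (eval Γ s)
  -- if the prefix of `s` were not empty, its normal form would begin with `a` or `b`
  have ht' : t' = 0 := by
    by_contra h0
    have hg := (hr.isPrefixSuffix hab hadj t').geodesic
    have hne : (altWord a b t').reverse ≠ [] := by
      rw [Ne, ← List.length_eq_zero_iff, List.length_reverse, length_altWord]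
      omega
    obtain ⟨c, u, hcu⟩ := List.exists_cons_of_ne_nil hne
    have hc : c = a ∨ c = b := mem_altWord (t := t') (by rw [← List.mem_reverse, hcu]; simp)
    have hg' : IsGeodesic Γ (c :: (u ++ r.reverse)) := by
      simpa [label, hcu] using hg
    refine hy.suffix_start c (u ++ r.reverse) hc hg' ?_
    change _ = eval Γ s
    rw [he, elt, evalPair, label, hcu]
    rfl
  subst ht'
  rw [elt_zero] at he
  have hs : s = r.reverse := by
    rcases hr.isShortlex hab hadj s he with h | h
    · exact h
    · rcases hy.suffix_shortlex r.reverse he.symm with h' | h'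
      · exact h'.symm
      · exact absurd h (Std.Asymm.asymm _ _ h')
  refine ⟨t, r, hr, ?_⟩
  rw [label, ← ht, ← hs, List.reverse_reverse]

end PrefixSuffix

/-! ### Busemann function and distance in terms of normal forms -/

section Busemann

variable {V : Type} {Γ : SimpleGraph V} {a b : V}

theorem ray_eq_elt (n : ℕ) : ray Γ a b n = elt Γ a b n [] := by
  rw [ray, elt_nil, altWord_natCast]
  congr 1
  induction n with
  | zero => rfl
  | succ n ih => simp [List.range_succ, ih, altNat]

variable [LinearOrder V]

theorem elt_even (hab : a ≠ b) (m : ℤ) :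
    elt Γ a b (2 * m) [] = ((system Γ).simple a * (system Γ).simple b) ^ m := by
  have h2 : ∀ m : ℤ, elt Γ a b (2 * (m + 1)) [] =
      elt Γ a b (2 * m) [] * ((system Γ).simple a * (system Γ).simple b) := by
    intro m
    rw [show 2 * (m + 1) = 2 * m + 1 + 1 by ring, elt_add_one hab, elt_add_one hab]
    have h1 : Even (2 * m) := even_two_mul m
    rw [altLetter, if_pos h1, altLetter, if_neg (by simp [parity_simps]), mul_assoc]
  induction m using Int.induction_on with
  | zero => simp [elt_zero]
  | succ n ih => rw [h2, ih, zpow_add_one]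
  | pred n ih =>
    have := h2 (-n - 1)
    rw [sub_add_cancel, ih] at this
    rw [zpow_sub_one, this, mul_inv_cancel_right]

theorem elt_odd (hab : a ≠ b) (m : ℤ) :
    elt Γ a b (2 * m + 1) [] =
      ((system Γ).simple a * (system Γ).simple b) ^ m * (system Γ).simple a := by
  rw [elt_add_one hab, elt_even hab]
  simp [altLetter]

theorem conj_zpow_of_mul_self_eq_one {G : Type*} [Group G] {x y : G} (hx : x * x = 1)
    (hy : y * y = 1) (m : ℤ) : x * (x * y) ^ m * x = (x * y) ^ (-m) := by
  have hx' : x⁻¹ = x := inv_eq_of_mul_eq_one_left hx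
  have hy' : y⁻¹ = y := inv_eq_of_mul_eq_one_left hy
  have h : x * (x * y) ^ m * x⁻¹ = (x * (x * y) * x⁻¹) ^ m := conj_zpow.symm
  rw [hx'] at h
  rw [h, zpow_neg, ← inv_zpow, mul_inv_rev, hx', hy', ← mul_assoc, hx, one_mul]

/-- The translation action of the dihedral group generated by `a` and `b` on itself preserves the
distance of signed lengths. -/
theorem exists_elt_inv_mul_elt (hab : a ≠ b) (n t : ℤ) :
    ∃ t' : ℤ, t'.natAbs = (t - n).natAbs ∧
      (elt Γ a b n [])⁻¹ * elt Γ a b t [] = elt Γ a b t' [] := by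
  have haa := (system Γ).simple_mul_simple_self a
  have hconj := conj_zpow_of_mul_self_eq_one haa ((system Γ).simple_mul_simple_self b)
  rcases Int.even_or_odd' n with ⟨m, rfl | rfl⟩ <;> rcases Int.even_or_odd' t with ⟨l, rfl | rfl⟩
  · refine ⟨2 * (l - m), by congr 1; ring, ?_⟩
    rw [elt_even hab, elt_even hab, elt_even hab, ← zpow_neg, ← zpow_add]
    congr 1; ring
  · refine ⟨2 * (l - m) + 1, by congr 1; ring, ?_⟩
    rw [elt_even hab, elt_odd hab, elt_odd hab, ← zpow_neg, ← mul_assoc, ← zpow_add]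
    congr 2; ring
  · refine ⟨2 * (m - l) + 1, by omega, ?_⟩
    rw [elt_even hab, elt_odd hab, elt_odd hab, mul_inv_rev, (system Γ).inv_simple, ← zpow_neg,
      mul_assoc, ← zpow_add, show m - l = -(-m + l) by ring, ← hconj, mul_assoc _ _ (_ : Grp Γ),
      mul_assoc _ _ (_ : Grp Γ), haa, mul_one]
  · refine ⟨2 * (m - l), by omega, ?_⟩
    rw [elt_even hab, elt_odd hab, elt_odd hab, mul_inv_rev, (system Γ).inv_simple, ← zpow_neg,
      mul_assoc, ← mul_assoc (_ ^ _), ← zpow_add, show m - l = -(-m + l) by ring, ← hconj,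
      mul_assoc]

variable [Fintype V] [DecidableRel Γ.Adj]

/-- The prefix and `γ(n)` are points of a line, on which the signed length is a coordinate; the
suffix adds its length to the distance. -/
theorem wordDist_ray_elt (hab : a ≠ b) (hadj : ¬ Γ.Adj a b) (n : ℕ) (t : ℤ) {r : List V}
    (hr : Good Γ a b r) :
    wordDist Γ (ray Γ a b n) (elt Γ a b t r) = (t - n).natAbs + r.length := by
  obtain ⟨t', h1, h2⟩ := exists_elt_inv_mul_elt (Γ := Γ) hab n t
  have h3 : ∀ t : ℤ, elt Γ a b t r = elt Γ a b t [] * eval Γ r.reverse := by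
    intro t
    rw [elt_nil, ← eval_append]
    rfl
  rw [wordDist, ray_eq_elt, h3, ← mul_assoc, h2, ← h3, length_elt hab hadj hr, h1]

/-- The Busemann function of the ray `(ab)^∞` at the point with prefix of signed length `t` and
suffix `r.reverse` is `r.length - t`. -/
theorem elt_mem_horosphere (hab : a ≠ b) (hadj : ¬ Γ.Adj a b) {t k : ℤ} {r : List V}
    (hr : Good Γ a b r) : elt Γ a b t r ∈ horosphere Γ a b k ↔ (r.length : ℤ) - t = k := by
  have h1 : (1 : Grp Γ) = elt Γ a b 0 [] := by simp [elt_zero]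
  have h : Tendsto (fun n : ℕ => (wordDist Γ (ray Γ a b n) (elt Γ a b t r) : ℤ) -
      (wordDist Γ (ray Γ a b n) 1 : ℤ)) atTop (𝓝 ((r.length : ℤ) - t)) := by
    apply tendsto_const_nhds.congr'
    filter_upwards [eventually_ge_atTop t.natAbs] with n hn
    rw [wordDist_ray_elt hab hadj n t hr, h1, wordDist_ray_elt hab hadj n 0 (r := []) trivial]
    simp only [List.length_nil]
    omega
  constructor
  · intro hk
    exact tendsto_nhds_unique h hk
  · rintro rfl
    exact h

/-- Two points of a horosphere are adjacent in the `2`-Rips graph exactly when they are different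
and one is obtained from the other by right multiplication by two letters. -/
theorem wordDist_le_two_iff (hab : a ≠ b) (hadj : ¬ Γ.Adj a b) {t t' : ℤ} {r r' : List V}
    (hr : Good Γ a b r) (hr' : Good Γ a b r') (h : (r.length : ℤ) - t = r'.length - t')
    (hne : r ≠ r') :
    wordDist Γ (elt Γ a b t r) (elt Γ a b t' r') ≤ 2 ↔
      ∃ c d, act Γ a b d (act Γ a b c t r).1 (act Γ a b c t r).2 = (t', r') := by
  constructor
  · intro hd
    obtain ⟨u, hu, he⟩ := (system Γ).exists_isReduced ((elt Γ a b t r)⁻¹ * elt Γ a b t' r')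
    rw [wordDist, he, hu.eq] at hd
    rw [inv_mul_eq_iff_eq_mul] at he
    match u, hd with
    | [], _ =>
      rw [CoxeterSystem.wordProd_nil, mul_one] at he
      exact absurd (elt_injective hab hadj hr' hr he).2 hne.symm
    -- one letter changes the value of the Busemann function
    | [c], _ =>
      rw [CoxeterSystem.wordProd_singleton, elt_mul_simple hab] at he
      obtain ⟨h1, h2⟩ := elt_injective hab hadj hr' (good_act hr) he
      have := busemann_act (Γ := Γ) (a := a) (b := b) c t r
      rw [← h1, ← h2] at this
      omega
    | [c, d], _ =>
      rw [CoxeterSystem.wordProd_cons, CoxeterSystem.wordProd_singleton, ← mul_assoc,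
        elt_mul_simple hab, elt_mul_simple hab] at he
      obtain ⟨h1, h2⟩ := elt_injective hab hadj hr' (good_act (good_act hr)) he
      exact ⟨c, d, Prod.ext h1.symm h2.symm⟩
  · rintro ⟨c, d, he⟩
    have h1 : elt Γ a b t' r' = elt Γ a b t r * (system Γ).simple c * (system Γ).simple d := by
      rw [elt_mul_simple hab, elt_mul_simple hab, he]
    rw [wordDist, h1, mul_assoc, inv_mul_cancel_left]
    refine ((system Γ).length_mul_le _ _).trans ?_
    rw [(system Γ).length_simple, (system Γ).length_simple]

end Busemann

/-! ### The shortlex order -/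

section Order

variable {V : Type} [LinearOrder V]

/-- The shortlex order on words which are stored with the last letter first. -/
def RevShortlex (r r' : List V) : Prop := List.Shortlex (· < ·) r.reverse r'.reverse

theorem RevShortlex.asymm {r r' : List V} (h : RevShortlex r r') : ¬ RevShortlex r' r :=
  Std.Asymm.asymm (r := List.Shortlex (· < ·)) _ _ h

theorem RevShortlex.ne {r r' : List V} (h : RevShortlex r r') : r ≠ r' := by
  rintro rfl; exact h.asymm h

theorem RevShortlex.of_ne {r r' : List V} (h : r ≠ r') : RevShortlex r r' ∨ RevShortlex r' r := by
  by_contra hc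
  push Not at hc
  have := Std.Trichotomous.trichotomous (r := List.Shortlex (· < ·)) r.reverse r'.reverse hc.1 hc.2
  exact h (List.reverse_injective this)

theorem RevShortlex.of_length_lt {r r' : List V} (h : r.length < r'.length) : RevShortlex r r' :=
  List.Shortlex.of_length_lt (by simpa using h)

theorem RevShortlex.length_le {r r' : List V} (h : RevShortlex r r') : r.length ≤ r'.length :=
  not_lt.1 fun hlt => h.asymm (.of_length_lt hlt)

theorem lex_append_singleton_iff {l l' : List V} (h : l.length = l'.length) (x x' : V) :
    List.Lex (· < ·) (l ++ [x]) (l' ++ [x']) ↔ List.Lex (· < ·) l l' ∨ l = l' ∧ x < x' := by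
  induction l generalizing l' with
  | nil =>
    obtain rfl : l' = [] := by simpa using h.symm
    simp
  | cons y l ih =>
    cases l' with
    | nil => simp at h
    | cons y' l' =>
      have ih := ih (l' := l') (by simpa using h)
      simp only [List.cons_append, List.cons_lex_cons_iff, ih, List.cons.injEq]
      tauto

/-- Comparison of two words that are read from their ends: whether the second one is smaller in the
shortlex order. The first argument is the answer in the case that the words that remain to be read
are equal; a difference found later takes precedence over it, because it concerns letters nearer to
the beginning. -/
def lessRev : Bool → List V → List V → Bool
  | o, [], [] => o
  | _, _ :: r, [] => lessRev true r []
  | _, [], _ :: r' => lessRev false [] r'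
  | o, x :: r, y :: r' => lessRev (if y < x then true else if x < y then false else o) r r'

theorem lessRev_eq_true_iff (o : Bool) (r r' : List V) :
    lessRev o r r' = true ↔ RevShortlex r' r ∨ r = r' ∧ o = true := by
  induction r generalizing r' o with
  | nil =>
    induction r' generalizing o with
    | nil => simp [lessRev, RevShortlex]
    | cons y r' ih =>
      rw [lessRev, ih]
      simp [RevShortlex]
  | cons x r ih =>
    cases r' with
    | nil =>
      rw [lessRev, ih]
      have h1 : RevShortlex [] (x :: r) := .of_length_lt (by simp)
      simp only [h1, true_or, iff_true]
      cases r with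
      | nil => simp
      | cons y r => exact .inl (.of_length_lt (by simp))
    | cons y r' =>
      rw [lessRev, ih]
      simp only [RevShortlex, List.shortlex_def, List.reverse_cons, List.length_append,
        List.length_reverse, List.length_singleton, List.cons.injEq, add_lt_add_iff_right,
        add_left_inj]
      by_cases hl : r'.length = r.length
      · rw [lex_append_singleton_iff (by simpa using hl), List.reverse_inj]
        rcases lt_trichotomy x y with h | h | h
        · simp only [h, h.not_gt, h.ne, if_true, if_false]
          simp
        · subst h; simp
        · simp only [h, h.ne', if_true]
          simp only [lt_irrefl, hl, true_and, false_or, and_true, false_and, or_false]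
          rw [eq_comm (a := r)]
      · have : r ≠ r' := fun h => hl (by rw [h])
        simp [hl, this]

end Order

/-! ### The tree of suffix words -/

section Enumeration

variable {V : Type} [LinearOrder V] [Fintype V] (Γ : SimpleGraph V) [DecidableRel Γ.Adj]
  (a b : V)

/-- The letters outside `F` in increasing order. -/
def allowed (F : Finset V) : List V := Fᶜ.sort

/-- The leaves of the tree of suffix words at height `m` above the node `r`, in depth-first
order. -/
def leaves : ℕ → List V → List (List V)
  | 0, r => [r]
  | m + 1, r => (allowed (forb Γ a b r)).flatMap fun c => leaves m (c :: r)

/-- The number of nodes of the tree of suffix words above the node `r` at height less than `m`. -/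
def nodes : ℕ → List V → ℕ
  | 0, _ => 0
  | m + 1, r => 1 + ((allowed (forb Γ a b r)).map fun c => nodes m (c :: r)).sum

/-- The suffix words of length less than `m`, in the shortlex order. -/
def wordsBelow (m : ℕ) : List (List V) := (List.range m).flatMap fun l => leaves Γ a b l []

variable {Γ a b}

theorem mem_allowed {F : Finset V} {c : V} : c ∈ allowed F ↔ c ∉ F := by
  simp [allowed]

theorem leaves_succ_length (m : ℕ) (r : List V) : (leaves Γ a b (m + 1) r).length =
    ∑ c ∈ (forb Γ a b r)ᶜ, (leaves Γ a b m (c :: r)).length := by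
  rw [leaves, List.length_flatMap, allowed, ← List.sum_toFinset _ (Finset.sort_nodup _ _),
    Finset.sort_toFinset]

theorem nodes_succ (m : ℕ) (r : List V) :
    nodes Γ a b (m + 1) r = nodes Γ a b m r + (leaves Γ a b m r).length := by
  induction m generalizing r with
  | zero => simp [nodes, leaves]
  | succ m ih =>
    rw [nodes, nodes, leaves, List.length_flatMap, add_assoc, ← List.sum_map_add]
    simp only [ih]

theorem wordsBelow_succ (m : ℕ) :
    wordsBelow Γ a b (m + 1) = wordsBelow Γ a b m ++ leaves Γ a b m [] := by
  simp [wordsBelow, List.range_succ]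

/-- The nodes at height less than `m` above the root are the suffix words of length less than
`m`. -/
theorem nodes_nil (m : ℕ) : nodes Γ a b m [] = (wordsBelow Γ a b m).length := by
  induction m with
  | zero => simp [nodes, wordsBelow]
  | succ m ih => rw [nodes_succ, ih, wordsBelow_succ, List.length_append]

theorem exists_of_mem_leaves {m : ℕ} {r s : List V} (hr : Good Γ a b r)
    (h : s ∈ leaves Γ a b m r) : ∃ q, s = q ++ r ∧ q.length = m ∧ Good Γ a b s := by
  induction m generalizing r with
  | zero => exact ⟨[], by simpa [leaves] using h, rfl, by simp [leaves] at h; rwa [h]⟩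
  | succ m ih =>
    rw [leaves, List.mem_flatMap] at h
    obtain ⟨c, hc, h⟩ := h
    obtain ⟨q, rfl, hq, hg⟩ := ih (r := c :: r) ⟨mem_allowed.1 hc, hr⟩ h
    exact ⟨q ++ [c], by simp, by simp [hq], hg⟩

theorem Good.of_append {q r : List V} (h : Good Γ a b (q ++ r)) : Good Γ a b r := by
  induction q with
  | nil => exact h
  | cons c q ih => exact ih h.2

theorem mem_leaves_append {q r : List V} (h : Good Γ a b (q ++ r)) :
    q ++ r ∈ leaves Γ a b q.length r := by
  induction q using List.reverseRecOn generalizing r with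
  | nil => simp [leaves]
  | append_singleton q c ih =>
    rw [List.append_assoc] at h ⊢
    rw [List.length_append, List.length_singleton, leaves, List.mem_flatMap]
    exact ⟨c, mem_allowed.2 h.of_append.1, ih h⟩

theorem mem_leaves_nil {m : ℕ} {s : List V} :
    s ∈ leaves Γ a b m [] ↔ s.length = m ∧ Good Γ a b s := by
  constructor
  · intro h
    obtain ⟨q, h1, h2, h3⟩ := exists_of_mem_leaves (r := []) trivial h
    rw [List.append_nil] at h1
    exact ⟨by rw [h1, h2], h3⟩
  · rintro ⟨rfl, h⟩
    simpa using mem_leaves_append (q := s) (r := []) (by simpa using h)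

theorem mem_wordsBelow {m : ℕ} {s : List V} :
    s ∈ wordsBelow Γ a b m ↔ s.length < m ∧ Good Γ a b s := by
  simp [wordsBelow, mem_leaves_nil]

/-- Depth-first search finds the words of a given length in alphabetical order. -/
theorem pairwise_leaves {m : ℕ} {r : List V} (hr : Good Γ a b r) :
    (leaves Γ a b m r).Pairwise RevShortlex := by
  induction m generalizing r with
  | zero => simp [leaves]
  | succ m ih =>
    rw [leaves, List.pairwise_flatMap]
    refine ⟨fun c hc => ih (r := c :: r) ⟨mem_allowed.1 hc, hr⟩, ?_⟩
    refine List.Pairwise.imp_of_mem ?_ (Finset.sortedLT_sort (forb Γ a b r)ᶜ).pairwise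
    intro c d hc hd hcd s hs s' hs'
    obtain ⟨q, rfl, hq, -⟩ := exists_of_mem_leaves (r := c :: r) ⟨mem_allowed.1 hc, hr⟩ hs
    obtain ⟨q', rfl, hq', -⟩ := exists_of_mem_leaves (r := d :: r) ⟨mem_allowed.1 hd, hr⟩ hs'
    apply List.Shortlex.of_lex (by simp [hq, hq'])
    simp only [List.reverse_append, List.reverse_cons, List.append_assoc, List.singleton_append]
    exact List.Lex.append_left _ (.rel hcd) _

theorem pairwise_wordsBelow (m : ℕ) : (wordsBelow Γ a b m).Pairwise RevShortlex := by
  rw [wordsBelow, List.pairwise_flatMap]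
  refine ⟨fun l _ => pairwise_leaves trivial, ?_⟩
  refine List.pairwise_lt_range.imp ?_
  intro l l' hl s hs s' hs'
  rw [mem_leaves_nil] at hs hs'
  exact .of_length_lt (by omega)

theorem mem_take_of_pairwise {α : Type*} {R : α → α → Prop} (hR : ∀ x y, R x y → ¬ R y x)
    {l : List α} (hl : l.Pairwise R) {n : ℕ} {x y : α} (hx : x ∈ l.take n) (hy : y ∈ l)
    (h : R y x) : y ∈ l.take n := by
  rw [← List.take_append_drop n l, List.mem_append] at hy
  rcases hy with hy | hy
  · exact hy
  · rw [← List.take_append_drop n l, List.pairwise_append] at hl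
    exact absurd (hl.2.2 x hx y hy) (hR _ _ h)

end Enumeration

/-! ### Exponential growth of the number of suffix words -/

section Growth

variable {V : Type}

/-- Besides `a` and `b` there is a vertex `c` which is not adjacent to one of them, called `e`, the
other one being called `f`: otherwise either the
vertices other than `a` and `b` form a clique, which separates `a` from `b`, or there is an induced
square. -/
theorem StandingAssumptions.exists_not_adj {Γ : SimpleGraph V} (hΓ : StandingAssumptions Γ)
    {a b : V} (hab : a ≠ b) (hadj : ¬ Γ.Adj a b) :
    ∃ c e f, c ≠ a ∧ c ≠ b ∧ (e = a ∧ f = b ∨ e = b ∧ f = a) ∧ ¬ Γ.Adj c e := by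
  by_contra! hcon
  have ha : ∀ c, c ≠ a → c ≠ b → Γ.Adj c a := fun c h1 h2 => hcon c a b h1 h2 (.inl ⟨rfl, rfl⟩)
  have hb : ∀ c, c ≠ a → c ≠ b → Γ.Adj c b := fun c h1 h2 => hcon c b a h1 h2 (.inr ⟨rfl, rfl⟩)
  by_cases hK : Γ.IsClique ({a, b}ᶜ : Set V)
  · have hp := hΓ.no_separating_clique _ hK
    rw [compl_compl] at hp
    obtain ⟨p⟩ := hp ⟨a, by simp⟩ ⟨b, by simp⟩
    cases p with
    | nil => exact hab rfl
    | cons h p =>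
      rename_i v
      obtain ⟨v, hv⟩ := v
      simp only [SimpleGraph.comap_adj, Function.Embedding.subtype_apply] at h
      rcases hv with rfl | hv
      · exact h.ne rfl
      · rw [Set.mem_singleton_iff] at hv
        subst hv
        exact hadj h
  · rw [SimpleGraph.isClique_iff, Set.Pairwise] at hK
    push Not at hK
    obtain ⟨c, hc, d, hd, hcd, hn⟩ := hK
    simp only [Set.mem_compl_iff, Set.mem_insert_iff, Set.mem_singleton_iff, not_or] at hc hd
    apply hΓ.no_induced_square
    have hca := ha c hc.1 hc.2
    have hcb := hb c hc.1 hc.2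
    have hda := ha d hd.1 hd.2
    have hdb := hb d hd.1 hd.2
    have hba : ¬ Γ.Adj b a := fun h => hadj h.symm
    have hdc : ¬ Γ.Adj d c := fun h => hn h.symm
    refine ⟨⟨⟨![a, c, b, d], ?_⟩, ?_⟩⟩
    · intro i j
      fin_cases i <;> fin_cases j <;> simp_all [eq_comm]
    · intro i j
      change Γ.Adj (![a, c, b, d] i) (![a, c, b, d] j) ↔ _
      rw [SimpleGraph.cycleGraph_adj]
      fin_cases i <;> fin_cases j <;>
        simp [hca, hcb, hda, hdb, hba, hdc, hadj, hn, hca.symm, hcb.symm, hda.symm, hdb.symm] <;>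
        decide

variable [LinearOrder V] [Fintype V] {Γ : SimpleGraph V} [DecidableRel Γ.Adj] {a b : V}

theorem not_mem_forb_cons {c d : V} {r : List V} (h : d ≠ c) (h' : ¬ Γ.Adj d c) :
    d ∉ forb Γ a b (c :: r) := by
  simp [mem_forb_cons, h, h']

/-- Words in which every second letter is `e` and each of the others is `c` or `f` are suffix words
if neither `c` nor `f` commutes with `e`: no letter of such a word can pass the one before it. -/
theorem two_pow_le_leaves {c e f : V} (hce : c ≠ e) (hfe : f ≠ e) (hcf : c ≠ f)
    (hc : ¬ Γ.Adj c e) (hf : ¬ Γ.Adj f e) (m : ℕ) (r : List V) :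
    2 ^ (m / 2) ≤ (leaves Γ a b m (e :: r)).length := by
  induction m using Nat.twoStepInduction generalizing r with
  | zero => simp [leaves]
  | one =>
    rw [leaves_succ_length]
    have h1 : ({f} : Finset V) ⊆ (forb Γ a b (e :: r))ᶜ := by
      simp [not_mem_forb_cons hfe hf]
    refine le_trans ?_ (Finset.sum_le_sum_of_subset h1)
    simp [leaves]
  | more m ih _ =>
    have h2 : ∀ x, x ≠ e → ¬ Γ.Adj x e →
        2 ^ (m / 2) ≤ (leaves Γ a b (m + 1) (x :: e :: r)).length := by
      intro x hx hxe
      rw [leaves_succ_length]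
      have h1 : ({e} : Finset V) ⊆ (forb Γ a b (x :: e :: r))ᶜ := by
        simp [not_mem_forb_cons hx.symm (fun h => hxe h.symm)]
      refine le_trans ?_ (Finset.sum_le_sum_of_subset h1)
      simpa using ih (x :: e :: r)
    rw [leaves_succ_length]
    have h1 : ({c, f} : Finset V) ⊆ (forb Γ a b (e :: r))ᶜ := by
      simp [Finset.insert_subset_iff, not_mem_forb_cons hfe hf, not_mem_forb_cons hce hc]
    refine le_trans ?_ (Finset.sum_le_sum_of_subset h1)
    rw [Finset.sum_pair hcf, show (m + 2) / 2 = m / 2 + 1 by omega, pow_succ]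
    have := h2 c hce hc
    have := h2 f hfe hf
    omega

/-- The number of suffix words of given length grows exponentially. -/
theorem two_pow_le_leaves_nil (hΓ : StandingAssumptions Γ) (hab : a ≠ b) (hadj : ¬ Γ.Adj a b)
    (m : ℕ) : 2 ^ ((m - 2) / 2) ≤ (leaves Γ a b m []).length := by
  obtain ⟨c, e, f, hca, hcb, hef, hce⟩ := hΓ.exists_not_adj hab hadj
  have hne : c ≠ e ∧ f ≠ e ∧ c ≠ f ∧ ¬ Γ.Adj f e := by
    rcases hef with ⟨rfl, rfl⟩ | ⟨rfl, rfl⟩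
    · exact ⟨hca, hab.symm, hcb, fun h => hadj h.symm⟩
    · exact ⟨hcb, hab, hca, hadj⟩
  have h0 : ({c} : Finset V) ⊆ (forb Γ a b [])ᶜ := by simp [forb, hca, hcb]
  have h1 : ({e} : Finset V) ⊆ (forb Γ a b [c])ᶜ := by
    simp [not_mem_forb_cons hne.1.symm (fun h => hce h.symm)]
  match m with
  | 0 => simp [leaves]
  | 1 =>
    rw [leaves_succ_length]
    refine le_trans ?_ (Finset.sum_le_sum_of_subset h0)
    simp [leaves]
  | m + 2 =>
    rw [leaves_succ_length]
    refine le_trans ?_ (Finset.sum_le_sum_of_subset h0)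
    rw [Finset.sum_singleton, leaves_succ_length]
    refine le_trans ?_ (Finset.sum_le_sum_of_subset h1)
    rw [Finset.sum_singleton]
    exact two_pow_le_leaves hne.1 hne.2.1 hne.2.2.1 hce hne.2.2.2 m [c]

/-- There are infinitely many suffix words. -/
theorem exists_lt_wordsBelow (hΓ : StandingAssumptions Γ) (hab : a ≠ b) (hadj : ¬ Γ.Adj a b)
    (n : ℕ) : ∃ l, n < (wordsBelow Γ a b (l + 1)).length := by
  refine ⟨n, ?_⟩
  induction n with
  | zero => simp [wordsBelow, leaves]
  | succ n ih =>
    rw [wordsBelow_succ, List.length_append]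
    have := two_pow_le_leaves_nil hΓ hab hadj (n + 1)
    have : 0 < 2 ^ ((n + 1 - 2) / 2) := by positivity
    omega

end Growth

/-! ### Instructions of stack machines -/

section StackMachine

open Turing

variable {K : Type} {A : K → Type} {Q : Type}

/-- An instruction of a stack machine: pop a stack and, depending on the symbol found (`none` if the
stack is empty), push finitely many symbols onto the stacks and enter a new state or halt
(`none`). -/
structure Instr (K : Type) (A : K → Type) (Q : Type) where
  /-- the stack from which a symbol is popped -/
  src : K
  /-- the symbols to push and the next state -/
  run : Option (A src) → List (Σ k, A k) × Option Q

/-- Push a list of symbols, the head of the list first. -/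
def pushAll [DecidableEq K] : List (Σ k, A k) → (∀ k, List (A k)) → ∀ k, List (A k)
  | [], S => S
  | x :: w, S => pushAll w (Function.update S x.1 (x.2 :: S x.1))

/-- The statement that pushes a list of symbols and then continues with `s`. -/
def pushStmt {σ : Type} (s : TM2.Stmt A Q σ) : List (Σ k, A k) → TM2.Stmt A Q σ
  | [] => s
  | x :: w => .push x.1 (fun _ => x.2) (pushStmt s w)

open Classical in
/-- The statement that continues with `g x` if the internal memory holds `e x`, for `x` in a given
list. -/
noncomputable def branchStmt {σ α : Type} (e : α → σ) (g : α → TM2.Stmt A Q σ) :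
    List α → TM2.Stmt A Q σ
  | [] => .halt
  | x :: l => .branch (fun v => decide (v = e x)) (g x) (branchStmt e g l)

/-- Leave the current statement for the state `q`, or halt. -/
def jumpStmt {σ : Type} : Option Q → TM2.Stmt A Q σ
  | none => .halt
  | some q => .goto fun _ => q

/-- The statement that executes an instruction. The internal memory of the machine serves to keep
the symbol popped, and is reset at the end. -/
noncomputable def Instr.toStmt (I : Instr K A Q) [Fintype (A I.src)] :
    TM2.Stmt A Q (Option (Σ k, A k)) :=
  .pop I.src (fun _ x => x.map fun y => ⟨I.src, y⟩) <|
    branchStmt (fun x : Option (A I.src) => x.map fun y => ⟨I.src, y⟩)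
      (fun x => pushStmt (.load (fun _ => none) (jumpStmt (I.run x).2)) (I.run x).1)
      Finset.univ.toList

variable [DecidableEq K]

theorem stepAux_pushStmt {σ : Type} (s : TM2.Stmt A Q σ) (w : List (Σ k, A k)) (v : σ)
    (S : ∀ k, List (A k)) :
    TM2.stepAux (pushStmt s w) v S = TM2.stepAux s v (pushAll w S) := by
  induction w generalizing S with
  | nil => rfl
  | cons x w ih => simp [pushStmt, pushAll, TM2.stepAux, ih]

theorem stepAux_branchStmt {σ α : Type} {e : α → σ} (he : Function.Injective e)
    (g : α → TM2.Stmt A Q σ) {l : List α} {x : α} (hx : x ∈ l) (S : ∀ k, List (A k)) :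
    TM2.stepAux (branchStmt e g l) (e x) S = TM2.stepAux (g x) (e x) S := by
  induction l with
  | nil => simp at hx
  | cons y l ih =>
    by_cases hxy : x = y
    · subst hxy; simp [branchStmt, TM2.stepAux]
    · have hne : e x ≠ e y := fun h => hxy (he h)
      simp only [branchStmt, TM2.stepAux, hne, decide_false, cond_false]
      exact ih (by simpa [hxy] using hx)

/-- A statement executes its instruction, if the internal memory is empty at the start, and leaves
the internal memory empty. -/
theorem stepAux_toStmt (I : Instr K A Q) [Fintype (A I.src)] (S : ∀ k, List (A k)) :
    TM2.stepAux I.toStmt none S =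
      ⟨(I.run (S I.src).head?).2, none,
        pushAll (I.run (S I.src).head?).1 (Function.update S I.src (S I.src).tail)⟩ := by
  have he : Function.Injective
      (fun x : Option (A I.src) => x.map fun y => (⟨I.src, y⟩ : Σ k, A k)) := by
    intro x y h
    cases x <;> cases y <;> simp_all
  rw [Instr.toStmt, TM2.stepAux, stepAux_branchStmt he _ (Finset.mem_toList.2 (Finset.mem_univ _)),
    stepAux_pushStmt, TM2.stepAux]
  cases (I.run (S I.src).head?).2 <;> rfl

end StackMachine

/-! ### The enumerating machine -/

section Machine

/-- The stacks of the enumerating machine. -/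
inductive Stk : Type
  /-- the input, from which one symbol is removed for each vertex that is written -/
  | inp
  /-- the height of the current node below the current level, in unary -/
  | rem
  /-- a single symbol: whether the signed length of the prefixes of the current level is even -/
  | par
  /-- the prefix of the current level -/
  | pre
  /-- the suffix word at the current node, each letter with the forbidden set before it -/
  | suf
  /-- auxiliary stack for the prefix -/
  | preBuf
  /-- auxiliary stack for the suffix -/
  | sufBuf
  /-- the prefix of a possible neighbour -/
  | pre2
  /-- the suffix of a possible neighbour -/
  | suf2
  /-- auxiliary stack for the suffix of the neighbour -/
  | suf2Buf
  /-- the vertices that are written, last symbol on top -/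
  | verts
  /-- the output, on which the edges are collected -/
  | out
  deriving DecidableEq

/-- The alphabets of the stacks. -/
def StkSym (V : Type) : Stk → Type
  | .inp | .par => Bool
  | .rem => Unit
  | .pre | .preBuf | .pre2 | .suf2 | .suf2Buf => V
  | .suf | .sufBuf => V × Finset V
  | .verts | .out => Symbol V

/-- The purposes for which the label of the current vertex is read: to write the vertex, to copy it
before it is multiplied by a pair of letters, to write an edge at it. -/
inductive Mode (V : Type) : Type
  | vertex
  | pair (j : V × V)
  | edge (j : V × V)
  deriving Fintype

set_option synthInstance.maxSize 1000 in
set_option synthInstance.maxHeartbeats 400000 in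
/-- The states of the enumerating machine. In `mulDown`, `mulPre` and `mulUp` the copy of the
current vertex is multiplied by the first letter of `j` (if `e` is `none`) or the second one (if `e`
is `some _`); `β` tells whether the signed length of its prefix is even, and `e` and `e'` tell
whether the first letter and the current one increase the Busemann function. In `mulUp`, `carry`
tells whether the letter is still to be inserted. In the other states, `o` is the intermediate or
final result of the comparison of the copy with the current vertex. -/
inductive State (V : Type) : Type
  | init
  | down (F : Finset V)
  | back
  | lift
  | liftPre (β : Bool)
  | leaf
  | readSuf (m : Mode V)
  | readPre (m : Mode V)
  | restorePre (m : Mode V)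
  | restoreSuf (m : Mode V)
  | readPar (j : V × V)
  | mulDown (j : V × V) (e : Option Bool) (β : Bool)
  | mulPre (j : V × V) (e : Option Bool) (β : Bool)
  | mulUp (j : V × V) (e : Option Bool) (β e' carry : Bool)
  | compare (j : V × V) (o : Bool)
  | compare2 (j : V × V) (o : Bool) (x : Option V)
  | restore (j : V × V) (o : Bool)
  | restore2 (j : V × V) (o : Bool)
  | writeSuf2 (j : V × V) (o : Bool)
  | writePre2 (j : V × V) (o : Bool)
  | clearSuf
  | clearPre
  | clearPar
  | flush
  deriving Fintype

instance : Fintype Stk :=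
  ⟨{.inp, .rem, .par, .pre, .suf, .preBuf, .sufBuf, .pre2, .suf2, .suf2Buf, .verts, .out},
    fun x => by cases x <;> simp⟩

open Classical in
noncomputable instance {V : Type} [Fintype V] : Fintype (Symbol V) :=
  Fintype.ofSurjective (α := V ⊕ Fin 4)
    (Sum.elim .letter ![.dot, .comma, .vertex, .edge]) fun x => by
      cases x with
      | letter c => exact ⟨.inl c, rfl⟩
      | dot => exact ⟨.inr 0, rfl⟩
      | comma => exact ⟨.inr 1, rfl⟩
      | vertex => exact ⟨.inr 2, rfl⟩
      | edge => exact ⟨.inr 3, rfl⟩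

noncomputable instance {V : Type} [Fintype V] (k : Stk) : Fintype (StkSym V k) := by
  cases k <;> unfold StkSym <;> infer_instance

/-- The contents of the stacks of the enumerating machine. -/
@[ext]
structure Store (V : Type) : Type where
  inp : List Bool
  rem : List Unit
  par : List Bool
  pre : List V
  suf : List (V × Finset V)
  preBuf : List V
  sufBuf : List (V × Finset V)
  pre2 : List V
  suf2 : List V
  suf2Buf : List V
  verts : List (Symbol V)
  out : List (Symbol V)

variable {V : Type}

/-- The content of a stack. -/
def Store.get (T : Store V) : ∀ k, List (StkSym V k)
  | .inp => T.inp
  | .rem => T.rem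
  | .par => T.par
  | .pre => T.pre
  | .suf => T.suf
  | .preBuf => T.preBuf
  | .sufBuf => T.sufBuf
  | .pre2 => T.pre2
  | .suf2 => T.suf2
  | .suf2Buf => T.suf2Buf
  | .verts => T.verts
  | .out => T.out

/-- Replace the content of a stack. -/
def Store.set (T : Store V) : ∀ k, List (StkSym V k) → Store V
  | .inp, l => { T with inp := l }
  | .rem, l => { T with rem := l }
  | .par, l => { T with par := l }
  | .pre, l => { T with pre := l }
  | .suf, l => { T with suf := l }
  | .preBuf, l => { T with preBuf := l }
  | .sufBuf, l => { T with sufBuf := l }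
  | .pre2, l => { T with pre2 := l }
  | .suf2, l => { T with suf2 := l }
  | .suf2Buf, l => { T with suf2Buf := l }
  | .verts, l => { T with verts := l }
  | .out, l => { T with out := l }

/-- Push a list of symbols, the head of the list first. -/
def Store.pushAll : List (Σ k, StkSym V k) → Store V → Store V
  | [], T => T
  | x :: w, T => pushAll w (T.set x.1 (x.2 :: T.get x.1))

theorem Store.get_set (T : Store V) (k : Stk) (l : List (StkSym V k)) :
    (T.set k l).get = Function.update T.get k l := by
  funext k'
  by_cases h : k' = k
  · subst h
    rw [Function.update_self]
    cases k' <;> rfl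
  · rw [Function.update_of_ne h]
    cases k <;> cases k' <;> first | rfl | exact absurd rfl h

theorem Store.get_pushAll (w : List (Σ k, StkSym V k)) (T : Store V) :
    (Store.pushAll w T).get = RACG.pushAll w T.get := by
  induction w generalizing T with
  | nil => rfl
  | cons x w ih => rw [Store.pushAll, ih, Store.get_set, RACG.pushAll]

/-- Execute an instruction. -/
def exec (I : Instr Stk (StkSym V) (State V)) (T : Store V) : Option (State V) × Store V :=
  ((I.run (T.get I.src).head?).2,
    Store.pushAll (I.run (T.get I.src).head?).1 (T.set I.src (T.get I.src).tail))

/-- `Reach P t x y`: the program `P` leads from the configuration `x` to `y` in at most `t`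
steps. -/
inductive Reach (P : State V → Instr Stk (StkSym V) (State V)) :
    ℕ → Option (State V) × Store V → Option (State V) × Store V → Prop
  | refl (t x) : Reach P t x x
  | step {t q T y} : Reach P t (exec (P q) T) y → Reach P (t + 1) (some q, T) y

variable {P : State V → Instr Stk (StkSym V) (State V)}

theorem Reach.mono {t t' : ℕ} {x y : Option (State V) × Store V} (h : Reach P t x y)
    (ht : t ≤ t') : Reach P t' x y := by
  induction h generalizing t' with
  | refl => exact .refl _ _
  | step _ ih =>
    obtain ⟨s, rfl⟩ := Nat.exists_eq_add_of_le' ht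
    rw [← add_assoc]
    exact .step (ih (by omega))

theorem Reach.trans {t t' : ℕ} {x y z : Option (State V) × Store V} (h : Reach P t x y)
    (h' : Reach P t' y z) : Reach P (t + t') x z := by
  induction h with
  | refl => exact h'.mono (by omega)
  | step _ ih => exact (Reach.step (ih h')).mono (by omega)

theorem Reach.head {t : ℕ} {q : State V} {T : Store V} {x y : Option (State V) × Store V}
    (h : exec (P q) T = x) (h' : Reach P t x y) : Reach P (t + 1) (some q, T) y :=
  .step (h ▸ h')

theorem Reach.congr {t : ℕ} {x y y' : Option (State V) × Store V} (h : Reach P t x y)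
    (hy : y = y') : Reach P t x y' :=
  hy ▸ h

/-- The element that follows `x` in a list. -/
def nextIn {α : Type} [DecidableEq α] (x : α) : List α → Option α
  | [] => none
  | y :: l => if y = x then l.head? else nextIn x l

theorem nextIn_append {α : Type} [DecidableEq α] {x : α} {l l' : List α}
    (h : (l ++ x :: l').Nodup) : nextIn x (l ++ x :: l') = l'.head? := by
  induction l with
  | nil => simp [nextIn]
  | cons y l ih =>
    rw [List.cons_append, List.nodup_cons] at h
    have : y ≠ x := by rintro rfl; simp at h
    rw [List.cons_append, nextIn, if_neg this, ih h.2]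

variable [LinearOrder V] [Fintype V] (Γ : SimpleGraph V) [DecidableRel Γ.Adj] (a b : V) (k : ℤ)

/-- All pairs of letters. -/
noncomputable def letterPairs (V : Type) [Fintype V] : List (V × V) := Finset.univ.toList

/-- The letter by which the state with arguments `j` and `e` multiplies. -/
def curLetter (j : V × V) (e : Option Bool) : V := if e = none then j.1 else j.2

/-- The symbols to be pushed onto the stack `s` after its top `x` was popped, in order to multiply
its content by the letter `c`. -/
def mulPush (s : Stk) (h : StkSym V s = V) (c : V) (x : Option V) : List (Σ k, StkSym V k) :=
  match x with
  | none => [⟨s, h.symm ▸ c⟩]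
  | some y => if y = c then [] else [⟨s, h.symm ▸ y⟩, ⟨s, h.symm ▸ c⟩]

/-- Begin to treat a pair of letters if there is one left, else leave the current vertex. -/
def pairState (j : Option (V × V)) : State V :=
  match j with
  | none => .back
  | some j => .readSuf (.pair j)

/-- The continuation after the label of the current vertex has been read. -/
noncomputable def afterRead (m : Mode V) : State V :=
  match m with
  | .vertex => pairState (letterPairs V).head?
  | .pair j => .readPar j
  | .edge j => pairState (nextIn j (letterPairs V))

/-- The continuation after a multiplication by a letter: after the first one there is a second
one; after the second one the vertices are compared if they have the same value of the Busemann
function. -/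
def afterMul (j : V × V) (e : Option Bool) (β e' : Bool) : State V :=
  match e with
  | none => .mulDown j (some e') β
  | some e => if e = e' then .writeSuf2 j false else .compare j false

/-- The comparison of two words, read from the end: one step of `lessRev`, where `x` and `y` are the
letters read, if there are any. -/
def compareState (j : V × V) (o : Bool) (x y : Option V) : State V :=
  match x, y with
  | none, none => .restore j o
  | some _, none => .compare j true
  | none, some _ => .compare j false
  | some x, some y => .compare j (if y < x then true else if x < y then false else o)

/-- The program of the enumerating machine. It runs through the suffix words of length `0`, `1`, …
by depth-first search (`down`, `back`, `lift`); at a word of the current length (`leaf`) it writes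
the vertex (`readSuf` to `restoreSuf`, mode `vertex`) and treats all pairs of letters. For each one,
it copies the vertex (mode `pair`), multiplies the copy by the two letters (`mulDown`, `mulPre`,
`mulUp`), compares the suffixes (`compare`, `compare2`), and, if the copy is a vertex of the same
horosphere that was listed before, writes an edge (`writeSuf2`, `writePre2`, mode `edge`). When the
input is exhausted, it clears the stacks and appends the edges to the vertices. -/
noncomputable def prog : State V → Instr Stk (StkSym V) (State V)
  -- for the empty suffix, the prefix has the signed length `-k`; nothing is popped here, because
  -- the stack is empty
  | .init => ⟨.sufBuf, fun _ =>
      ((altWord a b (-k)).reverse.map (fun c => ⟨.pre, c⟩) ++ [⟨.par, decide (Even (-k))⟩],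
        some (.down {a, b}))⟩
  | .down F => ⟨.rem, fun x => match x with
      | none => ([], some .leaf)
      | some _ => match (allowed F).head? with
        | none => ([⟨.rem, ()⟩], some .back)
        | some c => ([⟨.suf, (c, F)⟩], some (.down (nextForb Γ F c)))⟩
  | .back => ⟨.suf, fun x => match x with
      | none => ([], some .lift)
      | some (c, F) => match nextIn c (allowed F) with
        | none => ([⟨.rem, ()⟩], some .back)
        | some d => ([⟨.suf, (d, F)⟩], some (.down (nextForb Γ F d)))⟩
  -- for suffixes with one letter more, the signed length of the prefix is greater by one
  | .lift => ⟨.par, fun x => match x with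
      | none => ([], none)
      | some β => ([⟨.par, !β⟩], some (.liftPre β))⟩
  | .liftPre β => ⟨.pre, fun x =>
      (mulPush .pre rfl (if β then a else b) x ++ [⟨.rem, ()⟩], some (.down {a, b}))⟩
  | .leaf => ⟨.inp, fun x => match x with
      | none => ([], some .clearSuf)
      | some _ => ([], some (.readSuf .vertex))⟩
  -- an edge is written from its last symbol to its first one, while the label is read off the
  -- stacks; a vertex from its first symbol to its last one, while they are restored
  | .readSuf m => ⟨.suf, fun x => match x, m with
      | none, .edge _ => ([⟨.out, Symbol.dot⟩], some (.readPre m))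
      | none, _ => ([], some (.readPre m))
      | some y, .edge _ => ([⟨.sufBuf, y⟩, ⟨.out, Symbol.letter y.1⟩], some (.readSuf m))
      | some y, _ => ([⟨.sufBuf, y⟩], some (.readSuf m))⟩
  | .readPre m => ⟨.pre, fun x => match x, m with
      | none, .edge _ => ([⟨.out, Symbol.edge⟩], some (.restorePre m))
      | none, .vertex => ([⟨.verts, Symbol.vertex⟩], some (.restorePre m))
      | none, .pair _ => ([], some (.restorePre m))
      | some c, .edge _ => ([⟨.preBuf, c⟩, ⟨.out, Symbol.letter c⟩], some (.readPre m))
      | some c, _ => ([⟨.preBuf, c⟩], some (.readPre m))⟩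
  | .restorePre m => ⟨.preBuf, fun x => match x, m with
      | none, .vertex => ([⟨.verts, Symbol.dot⟩], some (.restoreSuf m))
      | none, _ => ([], some (.restoreSuf m))
      | some c, .vertex => ([⟨.pre, c⟩, ⟨.verts, Symbol.letter c⟩], some (.restorePre m))
      | some c, .pair _ => ([⟨.pre, c⟩, ⟨.pre2, c⟩], some (.restorePre m))
      | some c, .edge _ => ([⟨.pre, c⟩], some (.restorePre m))⟩
  | .restoreSuf m => ⟨.sufBuf, fun x => match x, m with
      | none, _ => ([], some (afterRead m))
      | some y, .vertex => ([⟨.suf, y⟩, ⟨.verts, Symbol.letter y.1⟩], some (.restoreSuf m))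
      | some y, .pair _ => ([⟨.suf, y⟩, ⟨.suf2, y.1⟩], some (.restoreSuf m))
      | some y, .edge _ => ([⟨.suf, y⟩], some (.restoreSuf m))⟩
  | .readPar j => ⟨.par, fun x => match x with
      | none => ([], none)
      | some β => ([⟨.par, β⟩], some (.mulDown j none β))⟩
  -- the letters with which the current letter commutes are put aside
  | .mulDown j e β => ⟨.suf2, fun x : Option V => match x with
      | none => if curLetter j e = a ∨ curLetter j e = b then ([], some (.mulPre j e β))
          else ([], some (.mulUp j e β true true))
      | some x => if x = curLetter j e then ([], some (.mulUp j e β false false))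
          else if Γ.Adj x (curLetter j e) then ([⟨.suf2Buf, x⟩], some (.mulDown j e β))
          else ([⟨.suf2, x⟩], some (.mulUp j e β true true))⟩
  | .mulPre j e β => ⟨.pre2, fun x => (mulPush .pre2 rfl (curLetter j e) x,
      some (.mulUp j e (!β) (if curLetter j e = a then !β else β) false))⟩
  -- the letters put aside are restored, and the current letter is inserted before the first of them
  -- that is greater, unless it was cancelled
  | .mulUp j e β e' carry => ⟨.suf2Buf, fun x : Option V => match x with
      | none => (if carry then [⟨.suf2, curLetter j e⟩] else [], some (afterMul j e β e'))
      | some x => if carry = true ∧ ¬ x < curLetter j e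
          then ([⟨.suf2, curLetter j e⟩, ⟨.suf2, x⟩], some (.mulUp j e β e' false))
          else ([⟨.suf2, x⟩], some (.mulUp j e β e' carry))⟩
  | .compare j o => ⟨.suf, fun x => match x with
      | none => ([], some (.compare2 j o none))
      | some y => ([⟨.sufBuf, y⟩], some (.compare2 j o (some y.1)))⟩
  | .compare2 j o x => ⟨.suf2, fun y => match y with
      | none => ([], some (compareState j o x none))
      | some y => ([⟨.suf2Buf, y⟩], some (compareState j o x (some y)))⟩
  | .restore j o => ⟨.sufBuf, fun x => match x with
      | none => ([], some (.restore2 j o))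
      | some y => ([⟨.suf, y⟩], some (.restore j o))⟩
  | .restore2 j o => ⟨.suf2Buf, fun x => match x with
      | none => ([], some (.writeSuf2 j o))
      | some y => ([⟨.suf2, y⟩], some (.restore2 j o))⟩
  -- if `o` is `false`, the copy is only removed
  | .writeSuf2 j o => ⟨.suf2, fun x => match x with
      | none => (if o then [⟨.out, Symbol.dot⟩] else [], some (.writePre2 j o))
      | some y => (if o then [⟨.out, Symbol.letter y⟩] else [], some (.writeSuf2 j o))⟩
  | .writePre2 j o => ⟨.pre2, fun x => match x with
      | none => if o then ([⟨.out, Symbol.comma⟩], some (.readSuf (.edge j)))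
          else ([], some (pairState (nextIn j (letterPairs V))))
      | some y => (if o then [⟨.out, Symbol.letter y⟩] else [], some (.writePre2 j o))⟩
  | .clearSuf => ⟨.suf, fun x => match x with
      | none => ([], some .clearPre)
      | some _ => ([], some .clearSuf)⟩
  | .clearPre => ⟨.pre, fun x => match x with
      | none => ([], some .clearPar)
      | some _ => ([], some .clearPre)⟩
  | .clearPar => ⟨.par, fun _ => ([], some .flush)⟩
  | .flush => ⟨.verts, fun x => match x with
      | none => ([], none)
      | some y => ([⟨.out, y⟩], some .flush)⟩

variable {Γ a b k}

/-- The result of an instruction when the symbols to be pushed and the next state are known. -/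
theorem exec_eq {q : State V} {T : Store V} {w : List (Σ k, StkSym V k)} {q' : Option (State V)}
    (h : (prog Γ a b k q).run (T.get (prog Γ a b k q).src).head? = (w, q')) :
    exec (prog Γ a b k q) T = (q', Store.pushAll w
      (T.set (prog Γ a b k q).src (T.get (prog Γ a b k q).src).tail)) := by
  rw [exec, h]

end Machine

/-! ### The routines of the machine -/

section Routines

theorem pushAll_mulPush_pre {V : Type} [LinearOrder V] (c : V) (p : List V) (T : Store V) :
    Store.pushAll (mulPush .pre rfl c p.head?) { T with pre := p.tail } =
      { T with pre := mulTop c p } := by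
  cases p with
  | nil => rfl
  | cons x p =>
    by_cases h : x = c
    · rw [show mulPush .pre rfl c (x :: p).head? = [] from if_pos h,
        show mulTop c (x :: p) = p from if_pos h]
      rfl
    · rw [show mulPush .pre rfl c (x :: p).head? = [⟨.pre, x⟩, ⟨.pre, c⟩] from if_neg h,
        show mulTop c (x :: p) = c :: x :: p from if_neg h]
      rfl

theorem pushAll_mulPush_pre2 {V : Type} [LinearOrder V] (c : V) (p : List V) (T : Store V) :
    Store.pushAll (mulPush .pre2 rfl c p.head?) { T with pre2 := p.tail } =
      { T with pre2 := mulTop c p } := by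
  cases p with
  | nil => rfl
  | cons x p =>
    by_cases h : x = c
    · rw [show mulPush .pre2 rfl c (x :: p).head? = [] from if_pos h,
        show mulTop c (x :: p) = p from if_pos h]
      rfl
    · rw [show mulPush .pre2 rfl c (x :: p).head? = [⟨.pre2, x⟩, ⟨.pre2, c⟩] from if_neg h,
        show mulTop c (x :: p) = c :: x :: p from if_neg h]
      rfl

variable {V : Type} [LinearOrder V] [Fintype V] {Γ : SimpleGraph V} [DecidableRel Γ.Adj] {a b : V}
  {k : ℤ}

/-- The list `l` if an edge is being written, else the empty list. -/
def Mode.ifEdge {α : Type} (m : Mode V) (l : List α) : List α :=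
  match m with
  | .edge _ => l
  | _ => []

/-- The list `l` if a vertex is being written, else the empty list. -/
def Mode.ifVertex {α : Type} (m : Mode V) (l : List α) : List α :=
  match m with
  | .vertex => l
  | _ => []

/-- The list `l` if the vertex is being copied, else the empty list. -/
def Mode.ifPair {α : Type} (m : Mode V) (l : List α) : List α :=
  match m with
  | .pair _ => l
  | _ => []

theorem reach_readSuf (m : Mode V) (l : List (V × Finset V)) (T : Store V) :
    Reach (prog Γ a b k) (l.length + 1) (some (.readSuf m), { T with suf := l })
      (some (.readPre m), { T with
        suf := []
        sufBuf := l.reverse ++ T.sufBuf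
        out := m.ifEdge (Symbol.dot :: (l.map fun y => Symbol.letter y.1).reverse) ++ T.out }) := by
  induction l generalizing T with
  | nil => cases m <;> exact .head rfl (.refl _ _)
  | cons y l ih =>
    cases m with
    | edge j =>
      refine .head rfl
        ((ih { T with sufBuf := y :: T.sufBuf, out := Symbol.letter y.1 :: T.out }).congr ?_)
      simp [Mode.ifEdge]
    | _ =>
      refine .head rfl ((ih { T with sufBuf := y :: T.sufBuf }).congr ?_)
      simp [Mode.ifEdge]

theorem reach_readPre (m : Mode V) (l : List V) (T : Store V) :
    Reach (prog Γ a b k) (l.length + 1) (some (.readPre m), { T with pre := l })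
      (some (.restorePre m), { T with
        pre := []
        preBuf := l.reverse ++ T.preBuf
        verts := m.ifVertex ([Symbol.vertex]) ++ T.verts
        out := m.ifEdge (Symbol.edge :: (l.map Symbol.letter).reverse) ++ T.out }) := by
  induction l generalizing T with
  | nil => cases m <;> exact .head rfl (.refl _ _)
  | cons y l ih =>
    cases m with
    | edge j =>
      refine .head rfl
        ((ih { T with preBuf := y :: T.preBuf, out := Symbol.letter y :: T.out }).congr ?_)
      simp [Mode.ifEdge, Mode.ifVertex]
    | _ =>
      refine .head rfl ((ih { T with preBuf := y :: T.preBuf }).congr ?_)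
      simp [Mode.ifEdge, Mode.ifVertex]

theorem reach_restorePre (m : Mode V) (l : List V) (T : Store V) :
    Reach (prog Γ a b k) (l.length + 1) (some (.restorePre m), { T with preBuf := l })
      (some (.restoreSuf m), { T with
        preBuf := []
        pre := l.reverse ++ T.pre
        pre2 := m.ifPair l.reverse ++ T.pre2
        verts := m.ifVertex (Symbol.dot :: (l.map Symbol.letter).reverse) ++ T.verts }) := by
  induction l generalizing T with
  | nil => cases m <;> exact .head rfl (.refl _ _)
  | cons y l ih =>
    cases m with
    | vertex =>
      refine .head rfl
        ((ih { T with pre := y :: T.pre, verts := Symbol.letter y :: T.verts }).congr ?_)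
      simp [Mode.ifVertex, Mode.ifPair]
    | pair j =>
      refine .head rfl ((ih { T with pre := y :: T.pre, pre2 := y :: T.pre2 }).congr ?_)
      simp [Mode.ifVertex, Mode.ifPair]
    | edge j =>
      refine .head rfl ((ih { T with pre := y :: T.pre }).congr ?_)
      simp [Mode.ifVertex, Mode.ifPair]

theorem reach_restoreSuf (m : Mode V) (l : List (V × Finset V)) (T : Store V) :
    Reach (prog Γ a b k) (l.length + 1) (some (.restoreSuf m), { T with sufBuf := l })
      (some (afterRead m), { T with
        sufBuf := []
        suf := l.reverse ++ T.suf
        suf2 := m.ifPair (l.map Prod.fst).reverse ++ T.suf2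
        verts := m.ifVertex ((l.map fun y => Symbol.letter y.1).reverse) ++ T.verts }) := by
  induction l generalizing T with
  | nil => cases m <;> exact .head rfl (.refl _ _)
  | cons y l ih =>
    cases m with
    | vertex =>
      refine .head rfl
        ((ih { T with suf := y :: T.suf, verts := Symbol.letter y.1 :: T.verts }).congr ?_)
      simp [Mode.ifVertex, Mode.ifPair]
    | pair j =>
      refine .head rfl ((ih { T with suf := y :: T.suf, suf2 := y.1 :: T.suf2 }).congr ?_)
      simp [Mode.ifVertex, Mode.ifPair]
    | edge j =>
      refine .head rfl ((ih { T with suf := y :: T.suf }).congr ?_)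
      simp [Mode.ifVertex, Mode.ifPair]

/-- Read the label of the current vertex and restore it. -/
theorem reach_read (m : Mode V) (T : Store V) (hp : T.preBuf = []) (hs : T.sufBuf = []) :
    Reach (prog Γ a b k) (2 * (T.suf.length + T.pre.length) + 4) (some (.readSuf m), T)
      (some (afterRead m), { T with
        pre2 := m.ifPair T.pre ++ T.pre2
        suf2 := m.ifPair (T.suf.map Prod.fst) ++ T.suf2
        verts := m.ifVertex (Symbol.vertex ::
          encodeLabel (T.pre.reverse, (T.suf.map Prod.fst).reverse)).reverse ++ T.verts
        out := m.ifEdge (Symbol.edge ::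
          encodeLabel (T.pre.reverse, (T.suf.map Prod.fst).reverse)) ++ T.out }) := by
  let T1 : Store V := { T with
    suf := []
    sufBuf := T.suf.reverse ++ T.sufBuf
    out := m.ifEdge (Symbol.dot :: (T.suf.map fun y => Symbol.letter y.1).reverse) ++ T.out }
  let T2 : Store V := { T1 with
    pre := []
    preBuf := T.pre.reverse ++ T.preBuf
    verts := m.ifVertex [Symbol.vertex] ++ T1.verts
    out := m.ifEdge (Symbol.edge :: (T.pre.map Symbol.letter).reverse) ++ T1.out }
  let T3 : Store V := { T2 with
    preBuf := []
    pre := T2.preBuf.reverse ++ T2.pre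
    pre2 := m.ifPair T2.preBuf.reverse ++ T2.pre2
    verts := m.ifVertex (Symbol.dot :: (T2.preBuf.map Symbol.letter).reverse) ++ T2.verts }
  have h1 : Reach (prog Γ a b k) _ (some (.readSuf m), T) (_, T1) := reach_readSuf m T.suf T
  have h2 := h1.trans (reach_readPre m T.pre T1)
  have h3 := h2.trans (reach_restorePre m T2.preBuf T2)
  have h4 := h3.trans (reach_restoreSuf m T3.sufBuf T3)
  refine (h4.mono (le_of_eq ?_)).congr ?_
  · simp only [T3, T2, T1, hp, hs, List.length_append, List.length_reverse, List.length_nil]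
    ring
  · simp only [T3, T2, T1, hp, hs]
    cases m <;>
      simp [Mode.ifEdge, Mode.ifVertex, Mode.ifPair, encodeLabel, List.map_reverse,
        Function.comp_def]

/-- Multiplication by a letter up to the point where all letters below the place where it acts are
restored. If `carry` is true, then the letter is still to be inserted. -/
theorem reach_mulDown (hab : a ≠ b) (j : V × V) (e : Option Bool) (t : ℤ) (r : List V)
    (T : Store V) (z : List V) {c : V} (hc : curLetter j e = c) :
    ∃ e' carry r', Reach (prog Γ a b k) (2 * r.length + 2)
      (some (.mulDown j e (decide (Even t))),
        { T with pre2 := altWord a b t, suf2 := r, suf2Buf := z })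
      (some (.mulUp j e (decide (Even (act Γ a b c t r).1)) e' carry),
        { T with pre2 := altWord a b (act Γ a b c t r).1, suf2 := r', suf2Buf := z }) ∧
      (carry = true → r' = r ∧ (act Γ a b c t r).2 = c :: r) ∧
      (carry = false → r' = (act Γ a b c t r).2 ∧ (act Γ a b c t r).2 ≠ c :: r) ∧
      (e' = true ↔ ((act Γ a b c t r).2.length : ℤ) - (act Γ a b c t r).1 = r.length - t + 1) := by
  induction r generalizing z with
  | nil =>
    by_cases hcab : c = a ∨ c = b
    · have h2 : (act Γ a b c t []).2 = [] := by
        simp only [act]; split_ifs <;> simp_all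
      refine ⟨if c = a then !(decide (Even t)) else decide (Even t), false, [], ?_, by simp,
        by simp [h2], ?_⟩
      · have h3 := pushAll_mulPush_pre2 c (altWord a b t) { T with suf2 := [], suf2Buf := z }
        rw [mulTop_altWord Γ hab hcab] at h3
        have h4 : decide (Even (act Γ a b c t []).1) = !decide (Even t) := by
          simp only [act]
          split_ifs <;> simp_all [parity_simps]
        rw [h4]
        subst hc
        exact .head (exec_eq (if_pos hcab)) (.head (congrArg (Prod.mk _) h3) (.refl _ _))
      · rw [h2]
        simp only [act]
        by_cases hca : c = a
        · by_cases ht : Even t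
          · simp [hca, ht]; omega
          · simp [hca, ht]; omega
        · have hcb : c = b := by tauto
          by_cases ht : Even t
          · simp [hcb, hab.symm, ht]; omega
          · simp [hcb, hab.symm, ht]; omega
    · have h1 : act Γ a b c t [] = (t, [c]) := by
        push Not at hcab
        simp [act, hcab.1, hcab.2]
      refine ⟨true, true, [], ?_, by simp [h1], by simp, by simp [h1]; ring⟩
      rw [h1]
      subst hc
      exact .head (exec_eq (if_neg hcab)) (.refl _ _)
  | cons x r ih =>
    by_cases hx : x = c
    · subst hx
      rw [act_self]
      refine ⟨false, false, r, ?_, by simp, ?_, by simp; omega⟩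
      · exact .head (exec_eq (if_pos hc.symm)) (.refl _ _)
      · simp only [true_and, forall_const]
        intro h
        have := congrArg List.length h
        simp at this
        omega
    by_cases hxc : Γ.Adj x c
    · obtain ⟨e', carry, r', h1, h2, h3, h4⟩ := ih (x :: z)
      have hd : exec (prog Γ a b k (.mulDown j e (decide (Even t))))
          { T with pre2 := altWord a b t, suf2 := x :: r, suf2Buf := z } =
          (some (.mulDown j e (decide (Even t))),
            { T with pre2 := altWord a b t, suf2 := r, suf2Buf := x :: z }) := by
        subst hc
        exact exec_eq (w := [⟨.suf2Buf, x⟩]) (q' := some (.mulDown j e (decide (Even t))))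
          ((if_neg hx).trans (if_pos hxc))
      have hlen : 2 * (x :: r).length + 2 = (2 * r.length + 2) + 1 + 1 := by simp; ring
      rw [hlen]
      by_cases hA : (act Γ a b c t r).2 = c :: r ∧ x < c
      · have hcar : carry = true := by
          by_contra hcon
          exact (h3 (by simpa using hcon)).2 hA.1
        subst hcar
        obtain ⟨rfl, -⟩ := h2 rfl
        have ht := act_fst_of_snd_eq hA.1
        rw [act_top hxc hA.1 hA.2]
        refine ⟨e', true, x :: r', ?_, by simp, by simp, ?_⟩
        · rw [ht] at h1
          subst hc
          exact .head hd ((h1.trans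
            (.head (exec_eq (if_neg fun h => h.2 hA.2)) (.refl 0 _))).mono (by omega))
        · rw [h4, hA.1, ht]; simp; omega
      · rw [act_deep hxc hA]
        refine ⟨e', false, x :: (act Γ a b c t r).2, ?_, by simp, by simp [hx], ?_⟩
        · subst hc
          cases carry with
          | false =>
            obtain ⟨rfl, -⟩ := h3 rfl
            exact .head hd ((h1.trans
              (.head rfl (.refl 0 _))).mono
                (by omega))
          | true =>
            obtain ⟨rfl, h5⟩ := h2 rfl
            have hlt : ¬ x < curLetter j e := fun h => hA ⟨h5, h⟩
            rw [h5]
            exact .head hd ((h1.trans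
              (.head (exec_eq (if_pos ⟨rfl, hlt⟩)) (.refl 0 _))).mono (by omega))
        · rw [h4]; simp; omega
    · rw [act_of_not_adj hx hxc]
      refine ⟨true, true, x :: r, ?_, by simp, by simp, by simp; omega⟩
      subst hc
      exact .head (exec_eq (w := [⟨.suf2, x⟩])
        (q' := some (.mulUp j e (decide (Even t)) true true))
        ((if_neg hx).trans (if_neg hxc))) (.refl _ _)

/-- Multiplication by a letter. -/
theorem reach_mul (hab : a ≠ b) (j : V × V) (e : Option Bool) (t : ℤ) (r : List V)
    (T : Store V) {c : V} (hc : curLetter j e = c) :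
    ∃ e', Reach (prog Γ a b k) (2 * r.length + 3)
      (some (.mulDown j e (decide (Even t))),
        { T with pre2 := altWord a b t, suf2 := r, suf2Buf := [] })
      (some (afterMul j e (decide (Even (act Γ a b c t r).1)) e'),
        { T with
          pre2 := altWord a b (act Γ a b c t r).1
          suf2 := (act Γ a b c t r).2
          suf2Buf := [] }) ∧
      (e' = true ↔ ((act Γ a b c t r).2.length : ℤ) - (act Γ a b c t r).1 = r.length - t + 1) := by
  obtain ⟨e', carry, r', h1, h2, h3, h4⟩ := reach_mulDown (Γ := Γ) (k := k) hab j e t r T [] hc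
  subst hc
  cases carry with
  | false =>
    obtain ⟨rfl, -⟩ := h3 rfl
    exact ⟨e', h1.trans (.head rfl (.refl 0 _)), h4⟩
  | true =>
    obtain ⟨rfl, h5⟩ := h2 rfl
    rw [h5] at h4 ⊢
    exact ⟨e', h1.trans (.head rfl (.refl 0 _)), h4⟩

/-- Compare the suffix of the current vertex with the suffix of the possible neighbour. -/
theorem reach_compare (j : V × V) (o : Bool) (l : List (V × Finset V)) (r : List V) (T : Store V) :
    Reach (prog Γ a b k) (2 * (l.length + r.length) + 2)
      (some (.compare j o), { T with suf := l, suf2 := r })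
      (some (.restore j (lessRev o (l.map Prod.fst) r)), { T with
        suf := []
        sufBuf := l.reverse ++ T.sufBuf
        suf2 := []
        suf2Buf := r.reverse ++ T.suf2Buf }) := by
  induction l generalizing o r T with
  | nil =>
    induction r generalizing o T with
    | nil =>
      have h : lessRev o (([] : List (V × Finset V)).map Prod.fst) [] = o := by simp [lessRev]
      rw [h]
      exact .head rfl (.head rfl (.refl _ _))
    | cons y r ih =>
      refine Reach.mono (t := (2 * (([] : List (V × Finset V)).length + r.length) + 2) + 1 + 1)
        (.head rfl (.head rfl ((ih false { T with suf2Buf := y :: T.suf2Buf }).congr ?_)))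
        (by simp; omega)
      simp [lessRev]
  | cons x l ih =>
    cases r with
    | nil =>
      refine Reach.mono (t := (2 * (l.length + ([] : List V).length) + 2) + 1 + 1)
        (.head rfl (.head rfl ((ih true [] { T with sufBuf := x :: T.sufBuf }).congr ?_)))
        (by simp; omega)
      simp [lessRev]
    | cons y r =>
      refine Reach.mono (t := (2 * (l.length + r.length) + 2) + 1 + 1)
        (.head rfl (.head rfl ((ih (if y < x.1 then true else if x.1 < y then false else o)
          r { T with sufBuf := x :: T.sufBuf, suf2Buf := y :: T.suf2Buf }).congr ?_)))
        (by simp; omega)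
      simp [lessRev]

theorem reach_restore (j : V × V) (o : Bool) (l : List (V × Finset V)) (T : Store V) :
    Reach (prog Γ a b k) (l.length + 1) (some (.restore j o), { T with sufBuf := l })
      (some (.restore2 j o), { T with suf := l.reverse ++ T.suf, sufBuf := [] }) := by
  induction l generalizing T with
  | nil => exact .head rfl (.refl _ _)
  | cons x l ih =>
    refine .head rfl ((ih { T with suf := x :: T.suf }).congr ?_)
    simp

theorem reach_restore2 (j : V × V) (o : Bool) (l : List V) (T : Store V) :
    Reach (prog Γ a b k) (l.length + 1) (some (.restore2 j o), { T with suf2Buf := l })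
      (some (.writeSuf2 j o), { T with suf2 := l.reverse ++ T.suf2, suf2Buf := [] }) := by
  induction l generalizing T with
  | nil => exact .head rfl (.refl _ _)
  | cons x l ih =>
    refine .head rfl ((ih { T with suf2 := x :: T.suf2 }).congr ?_)
    simp

theorem reach_writeSuf2 (j : V × V) (o : Bool) (l : List V) (T : Store V) :
    Reach (prog Γ a b k) (l.length + 1) (some (.writeSuf2 j o), { T with suf2 := l })
      (some (.writePre2 j o), { T with
        suf2 := []
        out := (if o then Symbol.dot :: (l.map Symbol.letter).reverse else []) ++ T.out }) := by
  induction l generalizing T with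
  | nil => cases o <;> exact .head rfl (.refl _ _)
  | cons x l ih =>
    cases o with
    | false => exact .head rfl (ih T)
    | true =>
      refine .head rfl ((ih { T with out := Symbol.letter x :: T.out }).congr ?_)
      simp

theorem reach_writePre2 (j : V × V) (o : Bool) (l : List V) (T : Store V) :
    Reach (prog Γ a b k) (l.length + 1) (some (.writePre2 j o), { T with pre2 := l })
      (some (if o then .readSuf (.edge j) else pairState (nextIn j (letterPairs V))), { T with
        pre2 := []
        out := (if o then Symbol.comma :: (l.map Symbol.letter).reverse else []) ++ T.out }) := by
  induction l generalizing T with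
  | nil => cases o <;> exact .head rfl (.refl _ _)
  | cons x l ih =>
    cases o with
    | false => exact .head rfl (ih T)
    | true =>
      refine .head rfl ((ih { T with out := Symbol.letter x :: T.out }).congr ?_)
      simp

end Routines

/-! ### The treatment of a vertex -/

section Vertex

/-- The label of the vertex of the horosphere with the suffix word `r.reverse`. -/
def suffixLabel {V : Type} (a b : V) (k : ℤ) (r : List V) : Label V := label a b (r.length - k) r

theorem suffixLabel_injective {V : Type} {a b : V} {k : ℤ} :
    Function.Injective (suffixLabel a b k) := fun _ _ h =>
  List.reverse_injective (Prod.ext_iff.1 h).2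

/-- The text written on the vertex stack for a list of suffix words, last symbol first. -/
def vertsText {V : Type} (a b : V) (k : ℤ) (rs : List (List V)) : List (Symbol V) :=
  (rs.flatMap fun r => Symbol.vertex :: encodeLabel (suffixLabel a b k r)).reverse

theorem vertsText_append {V : Type} (a b : V) (k : ℤ) (rs rs' : List (List V)) :
    vertsText a b k (rs ++ rs') = vertsText a b k rs' ++ vertsText a b k rs := by
  simp [vertsText]

variable {V : Type} [LinearOrder V] [Fintype V] (Γ : SimpleGraph V) [DecidableRel Γ.Adj] (a b : V)

/-- The suffix stack of the machine at the node `r`: each letter comes with the set of letters that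
were forbidden when it was chosen. -/
def annotate : List V → List (V × Finset V)
  | [] => []
  | c :: r => (c, forb Γ a b r) :: annotate r

theorem map_fst_annotate (r : List V) : (annotate Γ a b r).map Prod.fst = r := by
  induction r with
  | nil => rfl
  | cons c r ih => rw [annotate, List.map_cons, ih]

theorem length_annotate (r : List V) : (annotate Γ a b r).length = r.length := by
  rw [← List.length_map (f := Prod.fst), map_fst_annotate]

/-- The stacks of the machine at the pair `(t, r)`, with all auxiliary stacks empty. -/
def conf (t : ℤ) (r : List V) (i m : ℕ) (vs out : List (Symbol V)) : Store V where
  inp := List.replicate i true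
  rem := List.replicate m ()
  par := [decide (Even t)]
  pre := altWord a b t
  suf := annotate Γ a b r
  preBuf := []
  sufBuf := []
  pre2 := []
  suf2 := []
  suf2Buf := []
  verts := vs
  out := out

/-- The result of multiplying the pair `(t, r)` by two letters. -/
def actPair (t : ℤ) (r : List V) (j : V × V) : ℤ × List V :=
  act Γ a b j.2 (act Γ a b j.1 t r).1 (act Γ a b j.1 t r).2

/-- Whether multiplication by two letters leads from `(t, r)` to a vertex of the same horosphere
that is listed earlier. -/
def accept (t : ℤ) (r : List V) (j : V × V) : Bool :=
  decide (((actPair Γ a b t r j).2.length : ℤ) - (actPair Γ a b t r j).1 = r.length - t) &&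
    lessRev false r (actPair Γ a b t r j).2

/-- The edge that is written for a vertex and a pair of letters, if any. -/
def edgeAt (t : ℤ) (r : List V) (j : V × V) : List (Label V × Label V) :=
  if accept Γ a b t r j then
    [(label a b t r, label a b (actPair Γ a b t r j).1 (actPair Γ a b t r j).2)] else []

/-- The encoding of an edge. -/
def edgeText (e : Label V × Label V) : List (Symbol V) :=
  Symbol.edge :: (encodeLabel e.1 ++ Symbol.comma :: encodeLabel e.2)

variable {Γ a b} {k : ℤ}

/-- From the multiplication by a pair of letters to the decision whether there is an edge. -/
theorem reach_decide (hab : a ≠ b) (t : ℤ) (r : List V) (j : V × V) (i m : ℕ)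
    (vs out : List (Symbol V)) :
    Reach (prog Γ a b k) (10 * r.length + 22)
      (some (.mulDown j none (decide (Even t))),
        { conf Γ a b t r i m vs out with pre2 := altWord a b t, suf2 := r })
      (some (.writeSuf2 j (accept Γ a b t r j)),
        { conf Γ a b t r i m vs out with
          pre2 := altWord a b (actPair Γ a b t r j).1
          suf2 := (actPair Γ a b t r j).2 }) := by
  have hs1 := size_act (Γ := Γ) (a := a) (b := b) j.1 t r
  have hs2 := size_act (Γ := Γ) (a := a) (b := b) j.2 (act Γ a b j.1 t r).1 (act Γ a b j.1 t r).2
  obtain ⟨e1, h1, he1⟩ := reach_mul (Γ := Γ) (k := k) hab j none t r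
    (conf Γ a b t r i m vs out) (c := j.1) rfl
  obtain ⟨e2, h2, he2⟩ := reach_mul (Γ := Γ) (k := k) hab j (some e1) (act Γ a b j.1 t r).1
    (act Γ a b j.1 t r).2 (conf Γ a b t r i m vs out) (c := j.2) rfl
  have h := h1.trans h2
  have hb1 := busemann_act (Γ := Γ) (a := a) (b := b) j.1 t r
  have hb2 := busemann_act (Γ := Γ) (a := a) (b := b) j.2 (act Γ a b j.1 t r).1
    (act Γ a b j.1 t r).2
  change _ ∧ (actPair Γ a b t r j).1.natAbs ≤ _ at hs2
  change (actPair Γ a b t r j).2.length ≤ _ ∧ _ at hs2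
  change Reach _ _ _ (some (afterMul _ _ _ _), { conf Γ a b t r i m vs out with
    pre2 := altWord a b (actPair Γ a b t r j).1
    suf2 := (actPair Γ a b t r j).2
    suf2Buf := [] }) at h
  change (e2 = true ↔ ((actPair Γ a b t r j).2.length : ℤ) - (actPair Γ a b t r j).1 = _) at he2
  change ((actPair Γ a b t r j).2.length : ℤ) - (actPair Γ a b t r j).1 = _ ∨
    ((actPair Γ a b t r j).2.length : ℤ) - (actPair Γ a b t r j).1 = _ at hb2
  -- the two letters keep the Busemann function if one increases it and the other does not
  have hbool : ∀ x y : Bool, x = y ↔ (x = true ↔ y = true) := by decide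
  by_cases he : e1 = e2
  · have hacc : accept Γ a b t r j = false := by
      rw [accept, Bool.and_eq_false_iff]
      left
      rw [hbool, he1, he2] at he
      simp only [decide_eq_false_iff_not]
      omega
    rw [afterMul, if_pos he] at h
    rw [hacc]
    exact h.mono (by omega)
  · have hacc : accept Γ a b t r j = lessRev false ((annotate Γ a b r).map Prod.fst)
        (actPair Γ a b t r j).2 := by
      rw [accept, map_fst_annotate, decide_eq_true, Bool.true_and]
      rw [hbool, he1, he2] at he
      omega
    rw [afterMul, if_neg he] at h
    have h3 := h.trans (reach_compare j false (annotate Γ a b r) (actPair Γ a b t r j).2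
      { conf Γ a b t r i m vs out with pre2 := altWord a b (actPair Γ a b t r j).1 })
    rw [← hacc] at h3
    have h4 := h3.trans (reach_restore j _ ((annotate Γ a b r).reverse ++ [])
      { conf Γ a b t r i m vs out with
        suf := []
        pre2 := altWord a b (actPair Γ a b t r j).1
        suf2 := []
        suf2Buf := (actPair Γ a b t r j).2.reverse ++ [] })
    have h5 := h4.trans (reach_restore2 j _ ((actPair Γ a b t r j).2.reverse ++ [])
      { conf Γ a b t r i m vs out with
        suf := ((annotate Γ a b r).reverse ++ []).reverse ++ []
        pre2 := altWord a b (actPair Γ a b t r j).1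
        suf2 := [] })
    refine (h5.mono ?_).congr ?_
    · simp only [List.append_nil, List.length_reverse, length_annotate]
      omega
    · simp [conf]

/-- The treatment of one pair of letters at a vertex: the time is linear in the length of its
label. -/
theorem reach_pair (hab : a ≠ b) (t : ℤ) (r : List V) (j : V × V) (i m : ℕ)
    (vs out : List (Symbol V)) :
    Reach (prog Γ a b k) (15 * (r.length + t.natAbs) + 40)
      (some (.readSuf (.pair j)), conf Γ a b t r i m vs out)
      (some (pairState (nextIn j (letterPairs V))), conf Γ a b t r i m vs
        ((edgeAt Γ a b t r j).flatMap edgeText ++ out)) := by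
  have hs1 := size_act (Γ := Γ) (a := a) (b := b) j.1 t r
  have hs2 := size_act (Γ := Γ) (a := a) (b := b) j.2 (act Γ a b j.1 t r).1 (act Γ a b j.1 t r).2
  change _ ∧ (actPair Γ a b t r j).1.natAbs ≤ _ at hs2
  change (actPair Γ a b t r j).2.length ≤ _ ∧ _ at hs2
  have h0 := (reach_read (Γ := Γ) (a := a) (b := b) (k := k) (.pair j)
    (conf Γ a b t r i m vs out) rfl rfl).congr (y' := (some (.readPar j),
      { conf Γ a b t r i m vs out with pre2 := altWord a b t, suf2 := r })) (by
        simp [conf, Mode.ifPair, Mode.ifVertex, Mode.ifEdge, map_fst_annotate, afterRead])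
  have h1 := h0.trans (.head rfl (reach_decide hab t r j i m vs out))
  have h2 := h1.trans (reach_writeSuf2 j _ (actPair Γ a b t r j).2
    { conf Γ a b t r i m vs out with pre2 := altWord a b (actPair Γ a b t r j).1 })
  have h3 := h2.trans (reach_writePre2 j _ (altWord a b (actPair Γ a b t r j).1)
    { conf Γ a b t r i m vs out with
      out := (if accept Γ a b t r j then
        Symbol.dot :: ((actPair Γ a b t r j).2.map Symbol.letter).reverse else []) ++ out })
  have hl : (conf Γ a b t r i m vs out).suf.length = r.length := length_annotate _ _ _ _
  have hl' : (conf Γ a b t r i m vs out).pre.length = t.natAbs := length_altWord _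
  have hl2 : (altWord a b (actPair Γ a b t r j).1).length = (actPair Γ a b t r j).1.natAbs :=
    length_altWord _
  by_cases hacc : accept Γ a b t r j = true
  · rw [hacc] at h3
    have h4 := h3.trans (reach_read (.edge j) _ rfl rfl)
    refine (h4.mono ?_).congr ?_
    · change _ + (2 * ((conf Γ a b t r i m vs out).suf.length +
        (conf Γ a b t r i m vs out).pre.length) + 4) ≤ _
      omega
    · simp [conf, Mode.ifPair, Mode.ifVertex, Mode.ifEdge, map_fst_annotate, afterRead, edgeAt,
        hacc, edgeText, label, encodeLabel, List.map_reverse]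
  · rw [Bool.not_eq_true] at hacc
    rw [hacc] at h3
    refine (h3.mono (by omega)).congr ?_
    simp [conf, edgeAt, hacc]

/-- The treatment of all pairs of letters at a vertex. -/
theorem reach_pairs (hab : a ≠ b) (t : ℤ) (r : List V) (i m : ℕ)
    (vs : List (Symbol V)) (l l' : List (V × V)) (hl : l' ++ l = letterPairs V)
    (out : List (Symbol V)) :
    Reach (prog Γ a b k) (l.length * (15 * (r.length + t.natAbs) + 40))
      (some (pairState l.head?), conf Γ a b t r i m vs out)
      (some .back, conf Γ a b t r i m vs
        (((l.flatMap (edgeAt Γ a b t r)).reverse.flatMap edgeText) ++ out)) := by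
  induction l generalizing l' out with
  | nil => exact .refl _ _
  | cons j l ih =>
    have h1 := reach_pair (Γ := Γ) (k := k) hab t r j i m vs out
    rw [← hl, nextIn_append (by rw [hl]; exact Finset.nodup_toList _)] at h1
    have h2 := h1.trans (ih (l' ++ [j]) (by simpa using hl) _)
    refine (h2.mono (le_of_eq (by simp; ring))).congr ?_
    have : (edgeAt Γ a b t r j).reverse = edgeAt Γ a b t r j := by
      rw [edgeAt]; split_ifs <;> rfl
    simp [List.flatMap_append, this]

/-- The edges that are written at a vertex. -/
noncomputable def edgesAt (Γ : SimpleGraph V) [DecidableRel Γ.Adj] (a b : V) (t : ℤ) (r : List V) :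
    List (Label V × Label V) :=
  (letterPairs V).flatMap (edgeAt Γ a b t r)

variable (Γ a b) (k) in
/-- The edges that are written for a list of suffix words. -/
noncomputable def edgesOf (rs : List (List V)) : List (Label V × Label V) :=
  rs.flatMap fun r => edgesAt Γ a b (r.length - k) r

variable (Γ a b) (k) in
/-- The text written on the output stack for a list of suffix words: the last edge comes first. -/
noncomputable def edgesText (rs : List (List V)) : List (Symbol V) :=
  (edgesOf Γ a b k rs).reverse.flatMap edgeText

theorem edgesText_append (rs rs' : List (List V)) :
    edgesText Γ a b k (rs ++ rs') = edgesText Γ a b k rs' ++ edgesText Γ a b k rs := by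
  simp [edgesText, edgesOf]

/-- The treatment of a vertex that is to be written. -/
theorem reach_leaf (hab : a ≠ b) {t : ℤ} {r : List V} (ht : (r.length : ℤ) - k = t) (i m : ℕ)
    (vs out : List (Symbol V)) :
    Reach (prog Γ a b k) (((letterPairs V).length + 1) * (15 * (r.length + t.natAbs) + 40))
      (some .leaf, conf Γ a b t r (i + 1) m vs out)
      (some .back, conf Γ a b t r i m (vertsText a b k [r] ++ vs)
        (edgesText Γ a b k [r] ++ out)) := by
  have h0 := (reach_read (Γ := Γ) (a := a) (b := b) (k := k) .vertex
    (conf Γ a b t r i m vs out) rfl rfl).congr (y' := (some (pairState (letterPairs V).head?),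
      conf Γ a b t r i m (vertsText a b k [r] ++ vs) out)) (by
        simp [conf, Mode.ifPair, Mode.ifVertex, Mode.ifEdge, map_fst_annotate, afterRead,
          vertsText, suffixLabel, label, ht])
  have h1 := h0.trans (reach_pairs hab t r i m _ (letterPairs V) [] rfl out)
  have hl : (conf Γ a b t r i m vs out).suf.length = r.length := length_annotate _ _ _ _
  have hl' : (conf Γ a b t r i m vs out).pre.length = t.natAbs := length_altWord _
  refine ((Reach.head (t := _) rfl h1).mono ?_).congr ?_
  · rw [hl, hl', add_mul, one_mul]
    omega
  · simp [edgesText, edgesOf, edgesAt, ht]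

end Vertex

/-! ### The depth-first search -/

section Search

/-- A bound for the number of steps that the machine spends at a leaf of level `l`: the prefix has
length `|l - k|`, the suffix has length `l`, and the time for reading the label and for each pair of
letters is linear in these lengths. -/
noncomputable def leafCost (V : Type) [Fintype V] (k : ℤ) (l : ℕ) : ℕ :=
  ((letterPairs V).length + 1) * (15 * (l + (l + k.natAbs)) + 40) + 2

theorem leafCost_mono {V : Type} [Fintype V] {k : ℤ} {l l' : ℕ} (h : l ≤ l') :
    leafCost V k l ≤ leafCost V k l' := by
  unfold leafCost
  gcongr

variable {V : Type} [LinearOrder V] [Fintype V] {Γ : SimpleGraph V} [DecidableRel Γ.Adj] {a b : V}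
  {k : ℤ}

variable (Γ a b) in
/-- The configuration in which the children of the node `r` in the list `l` are still to be
visited. -/
def childConf (t : ℤ) (r : List V) (i m : ℕ) (vs out : List (Symbol V)) :
    List V → Option (State V) × Store V
  | [] => (some .back, conf Γ a b t r i (m + 1) vs out)
  | c :: _ => (some (.down (forb Γ a b (c :: r))), conf Γ a b t (c :: r) i m vs out)

/-- From a node below the current level the search goes to the first child, or back. -/
theorem exec_down (t : ℤ) (r : List V) (i m : ℕ) (vs out : List (Symbol V)) :
    exec (prog Γ a b k (.down (forb Γ a b r))) (conf Γ a b t r i (m + 1) vs out) =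
      childConf Γ a b t r i m vs out (allowed (forb Γ a b r)) := by
  cases h : allowed (forb Γ a b r) with
  | nil =>
    refine exec_eq (w := [⟨.rem, ()⟩]) (q' := some .back) ?_
    change (match (allowed (forb Γ a b r)).head? with
      | none => _
      | some c => _) = _
    rw [h]
    rfl
  | cons c l =>
    refine exec_eq (w := [⟨.suf, (c, forb Γ a b r)⟩])
      (q' := some (.down (forb Γ a b (c :: r)))) ?_
    change (match (allowed (forb Γ a b r)).head? with
      | none => _
      | some c => _) = _
    rw [h]
    rfl

/-- After a child has been visited the search goes to the next child, or back. -/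
theorem exec_back (t : ℤ) (r : List V) (c : V) (l l' : List V)
    (hl : l' ++ c :: l = allowed (forb Γ a b r)) (i m : ℕ) (vs out : List (Symbol V)) :
    exec (prog Γ a b k .back) (conf Γ a b t (c :: r) i m vs out) =
      childConf Γ a b t r i m vs out l := by
  have hn : nextIn c (allowed (forb Γ a b r)) = l.head? := by
    rw [← hl]
    exact nextIn_append (by rw [hl]; exact Finset.sort_nodup _ _)
  cases l with
  | nil =>
    refine exec_eq (w := [⟨.rem, ()⟩]) (q' := some .back) ?_
    change (match nextIn c (allowed (forb Γ a b r)) with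
      | none => _
      | some c => _) = _
    rw [hn]
    rfl
  | cons d l =>
    refine exec_eq (w := [⟨.suf, (d, forb Γ a b r)⟩])
      (q' := some (.down (forb Γ a b (d :: r)))) ?_
    change (match nextIn c (allowed (forb Γ a b r)) with
      | none => _
      | some c => _) = _
    rw [hn]
    rfl

/-- The search through a subtree that consists of one leaf. -/
theorem reach_down_zero (hab : a ≠ b) {t : ℤ} {r : List V} (ht : (r.length : ℤ) - k = t) (i : ℕ)
    (vs out : List (Symbol V)) {D s : ℕ} (hD : leafCost V k r.length ≤ D) (hs : D ≤ s + 1) :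
    Reach (prog Γ a b k) s
      (some (.down (forb Γ a b r)), conf Γ a b t r (i + 1) 0 vs out)
      (some .back, conf Γ a b t r i 0 (vertsText a b k [r] ++ vs)
        (edgesText Γ a b k [r] ++ out)) := by
  refine (Reach.head rfl (reach_leaf hab ht i 0 vs out)).mono ?_
  have : ((letterPairs V).length + 1) * (15 * (r.length + t.natAbs) + 40) + 2 ≤
      leafCost V k r.length := by
    unfold leafCost
    gcongr
    omega
  omega

/-- The search through a subtree all of whose leaves are to be written. The time is counted such
that the step by which the search continues after the subtree is included. -/
theorem reach_subtree (hab : a ≠ b) {m : ℕ} {t : ℤ} {r : List V}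
    (ht : ((r.length + m : ℕ) : ℤ) - k = t) (i : ℕ) (vs out : List (Symbol V)) {D s : ℕ}
    (hD : leafCost V k (r.length + m) ≤ D)
    (hs : 2 * nodes Γ a b m r + D * (leaves Γ a b m r).length ≤ s + 1) :
    Reach (prog Γ a b k) s
      (some (.down (forb Γ a b r)), conf Γ a b t r (i + (leaves Γ a b m r).length) m vs out)
      (some .back, conf Γ a b t r i m (vertsText a b k (leaves Γ a b m r) ++ vs)
        (edgesText Γ a b k (leaves Γ a b m r) ++ out)) := by
  induction m generalizing r i vs out s with
  | zero =>
    exact reach_down_zero hab ht i vs out hD (by simpa [nodes, leaves] using hs)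
  | succ m ih =>
    have key : ∀ l l' : List V, l' ++ l = allowed (forb Γ a b r) → ∀ i vs out,
        Reach (prog Γ a b k) (l.map fun c => 2 * nodes Γ a b m (c :: r) +
            D * (leaves Γ a b m (c :: r)).length).sum
          (childConf Γ a b t r
            (i + (l.flatMap fun c => leaves Γ a b m (c :: r)).length) m vs out l)
          (some .back, conf Γ a b t r i (m + 1)
            (vertsText a b k (l.flatMap fun c => leaves Γ a b m (c :: r)) ++ vs)
            (edgesText Γ a b k (l.flatMap fun c => leaves Γ a b m (c :: r)) ++ out)) := by
      intro l
      induction l with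
      | nil => exact fun _ _ _ _ _ => .refl _ _
      | cons c l ihl =>
        intro l' hl i vs out
        have h1 := ih (r := c :: r) (by simpa [add_assoc, add_comm, add_left_comm] using ht)
          (i + (l.flatMap fun c => leaves Γ a b m (c :: r)).length) vs out
          (s := 2 * nodes Γ a b m (c :: r) + D * (leaves Γ a b m (c :: r)).length - 1)
          (by simpa [add_assoc, add_comm, add_left_comm] using hD) (by omega)
        have h2 := h1.trans (.head (exec_back t r c l l' hl _ _ _ _)
          (ihl (l' ++ [c]) (by simpa using hl) i _ _))
        have hpos : 0 < 2 * nodes Γ a b m (c :: r) + D * (leaves Γ a b m (c :: r)).length := by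
          have : 0 < D := lt_of_lt_of_le (by unfold leafCost; omega) hD
          cases m with
          | zero => simpa [leaves] using Or.inr this
          | succ m => rw [nodes]; omega
        rw [List.flatMap_cons, vertsText_append, edgesText_append, List.append_assoc,
          List.append_assoc, List.map_cons, List.sum_cons, List.length_append]
        have e : i + ((leaves Γ a b m (c :: r)).length +
            (l.flatMap fun c => leaves Γ a b m (c :: r)).length) =
            i + (l.flatMap fun c => leaves Γ a b m (c :: r)).length +
              (leaves Γ a b m (c :: r)).length := by omega
        rw [e]
        exact h2.mono (by omega)
    refine (Reach.head (exec_down t r _ m vs out)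
      (key (allowed (forb Γ a b r)) [] rfl i vs out)).mono ?_
    rw [nodes, leaves, List.length_flatMap, ← List.sum_map_mul_left] at hs
    rw [List.sum_map_add, List.sum_map_mul_left]
    omega

/-- The search through a subtree of which only the first `i` leaves are to be written. -/
theorem reach_clear (hab : a ≠ b) {m : ℕ} {t : ℤ} {r : List V}
    (ht : ((r.length + m : ℕ) : ℤ) - k = t) {i : ℕ} (hi : i < (leaves Γ a b m r).length)
    (vs out : List (Symbol V)) {D : ℕ} (hD : leafCost V k (r.length + m) ≤ D) :
    ∃ r' : List V, r'.length = r.length + m ∧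
    Reach (prog Γ a b k) (2 * nodes Γ a b m r + D * i + 2)
      (some (.down (forb Γ a b r)), conf Γ a b t r i m vs out)
      (some .clearSuf, conf Γ a b t r' 0 0 (vertsText a b k ((leaves Γ a b m r).take i) ++ vs)
        (edgesText Γ a b k ((leaves Γ a b m r).take i) ++ out)) := by
  induction m generalizing r i vs out with
  | zero =>
    obtain rfl : i = 0 := by simpa [leaves] using hi
    exact ⟨r, rfl, .head rfl (.head rfl (.refl _ _))⟩
  | succ m ih =>
    have key : ∀ l l' : List V, l' ++ l = allowed (forb Γ a b r) → ∀ i vs out,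
        i < (l.flatMap fun c => leaves Γ a b m (c :: r)).length →
        ∃ r' : List V, r'.length = r.length + (m + 1) ∧
        Reach (prog Γ a b k)
          (2 * (l.map fun c => nodes Γ a b m (c :: r)).sum + D * i + 2)
          (childConf Γ a b t r i m vs out l)
          (some .clearSuf, conf Γ a b t r' 0 0
            (vertsText a b k ((l.flatMap fun c => leaves Γ a b m (c :: r)).take i) ++ vs)
            (edgesText Γ a b k ((l.flatMap fun c => leaves Γ a b m (c :: r)).take i) ++ out)) := by
      intro l
      induction l with
      | nil => intro _ _ _ _ _ h; simp at h
      | cons c l ihl =>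
        intro l' hl i vs out hi
        have ht' : (((c :: r).length + m : ℕ) : ℤ) - k = t := by
          simpa [add_assoc, add_comm, add_left_comm] using ht
        have hD' : leafCost V k ((c :: r).length + m) ≤ D := by
          simpa [add_assoc, add_comm, add_left_comm] using hD
        rw [List.flatMap_cons] at hi ⊢
        rw [List.map_cons, List.sum_cons]
        by_cases hc : i < (leaves Γ a b m (c :: r)).length
        · obtain ⟨r', hr', h1⟩ := ih (r := c :: r) ht' hc vs out hD'
          refine ⟨r', by rw [hr', List.length_cons]; omega, ?_⟩
          rw [List.take_append_of_le_length hc.le]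
          exact h1.mono (by omega)
        · obtain ⟨i', rfl⟩ := Nat.exists_eq_add_of_le' (not_lt.1 hc)
          obtain ⟨r', hr', h1⟩ := ihl (l' ++ [c]) (by simpa using hl) i'
            (vertsText a b k (leaves Γ a b m (c :: r)) ++ vs)
            (edgesText Γ a b k (leaves Γ a b m (c :: r)) ++ out)
            (by rw [List.length_append] at hi; omega)
          refine ⟨r', hr', ?_⟩
          have h2 := (reach_subtree hab (r := c :: r) ht' i' vs out
            (s := 2 * nodes Γ a b m (c :: r) + D * (leaves Γ a b m (c :: r)).length - 1)
            hD' (by omega)).trans (.head (exec_back t r c l l' hl _ _ _ _) h1)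
          rw [add_comm i', List.take_length_add_append, vertsText_append, edgesText_append,
            List.append_assoc, List.append_assoc]
          have hpos : 0 < 2 * nodes Γ a b m (c :: r) +
              D * (leaves Γ a b m (c :: r)).length := by
            have : 0 < D := lt_of_lt_of_le (by unfold leafCost; omega) hD
            cases m with
            | zero => simpa [leaves] using Or.inr this
            | succ m => rw [nodes]; omega
          rw [add_comm i'] at h2
          refine h2.mono ?_
          rw [mul_add D]
          omega
    rw [leaves] at hi
    obtain ⟨r', hr', h1⟩ := key (allowed (forb Γ a b r)) [] rfl i vs out hi
    refine ⟨r', hr', (Reach.head (exec_down t r _ m vs out) h1).mono ?_⟩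
    rw [nodes]
    omega

end Search

/-! ### The complete run -/

section Run

theorem Store.pushAll_append {V : Type} (w w' : List (Σ k, StkSym V k)) (T : Store V) :
    Store.pushAll (w ++ w') T = Store.pushAll w' (Store.pushAll w T) := by
  induction w generalizing T with
  | nil => rfl
  | cons x w ih => exact ih _

theorem length_vertsText_le {V : Type} {a b : V} {k : ℤ} {l : ℕ} {rs : List (List V)}
    (h : ∀ r ∈ rs, r.length ≤ l) :
    (vertsText a b k rs).length ≤ rs.length * (2 * l + k.natAbs + 2) := by
  induction rs with
  | nil => simp [vertsText]
  | cons r rs ih =>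
    have h1 := ih fun r hr => h r (.tail _ hr)
    have h2 := h r (.head _)
    have h3 : (vertsText a b k [r]).length ≤ 2 * l + k.natAbs + 2 := by
      simp only [vertsText, suffixLabel, label, encodeLabel, List.flatMap_cons, List.flatMap_nil,
        List.append_nil, List.length_reverse, List.length_cons, List.length_append,
        List.length_map, length_altWord]
      omega
    rw [← List.singleton_append, vertsText_append, List.length_append, List.length_append, add_mul]
    simp only [List.length_singleton, one_mul]
    omega

/-- The stacks at the start of the computation. -/
def startStore (V : Type) (n : ℕ) : Store V where
  inp := List.replicate n true
  rem := []
  par := []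
  pre := []
  suf := []
  preBuf := []
  sufBuf := []
  pre2 := []
  suf2 := []
  suf2Buf := []
  verts := []
  out := []

/-- The stacks at the end of the computation. -/
def finalStore {V : Type} (out : List (Symbol V)) : Store V where
  inp := []
  rem := []
  par := []
  pre := []
  suf := []
  preBuf := []
  sufBuf := []
  pre2 := []
  suf2 := []
  suf2Buf := []
  verts := []
  out := out

/-- A bound for the running time, if the search ends at the level `l`. -/
noncomputable def timeBound (V : Type) [Fintype V] (k : ℤ) (l n : ℕ) : ℕ :=
  l * (2 * n + 3) + leafCost V k l * n + n * (2 * l + k.natAbs + 2) + 2 * n + 2 * l + k.natAbs + 7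

variable {V : Type} [LinearOrder V] [Fintype V] {Γ : SimpleGraph V} [DecidableRel Γ.Adj] {a b : V}
  {k : ℤ}

theorem reach_init (n : ℕ) : Reach (prog Γ a b k) 1 (some .init, startStore V n)
    (some (.down {a, b}), conf Γ a b (-k) [] n 0 [] []) := by
  have h : ∀ f : V → Σ k, StkSym V k, f = (fun c => ⟨.pre, c⟩) → ∀ (l : List V) (T : Store V),
      Store.pushAll (l.reverse.map f) T = { T with pre := l ++ T.pre } := by
    intro f hf l
    induction l with
    | nil => exact fun _ => rfl
    | cons c l ih =>
      intro T
      rw [List.reverse_cons, List.map_append, Store.pushAll_append, ih]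
      subst hf
      rfl
  refine .head (exec_eq rfl) ((Reach.refl _ _).congr (congrArg (Prod.mk _) ?_))
  refine (Store.pushAll_append _ _ _).trans ?_
  refine (congrArg (Store.pushAll _) (h _ rfl (altWord a b (-k)) _)).trans ?_
  change ({ conf Γ a b (-k) [] n 0 [] [] with pre := altWord a b (-k) ++ [] } : Store V) = _
  rw [List.append_nil]
  rfl

/-- From a level of the search to the next one: the prefix becomes longer by one letter. -/
theorem reach_lift (hab : a ≠ b) (t : ℤ) (i m : ℕ) (vs out : List (Symbol V)) :
    Reach (prog Γ a b k) 3 (some .back, conf Γ a b t [] i m vs out)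
      (some (.down {a, b}), conf Γ a b (t + 1) [] i (m + 1) vs out) := by
  have h1 : (if decide (Even t) = true then a else b) = altLetter a b t := by simp [altLetter]
  have h2 : (!decide (Even t)) = decide (Even (t + 1)) := by
    rw [← decide_not, decide_eq_decide, Int.even_add_one]
  have h3 : exec (prog Γ a b k .lift) (conf Γ a b t [] i m vs out) =
      (some (.liftPre (decide (Even t))),
        { conf Γ a b t [] i m vs out with par := [!decide (Even t)] }) := rfl
  have h4 : exec (prog Γ a b k (.liftPre (decide (Even t))))
      { conf Γ a b t [] i m vs out with par := [!decide (Even t)] } =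
      (some (.down {a, b}), conf Γ a b (t + 1) [] i (m + 1) vs out) := by
    refine (exec_eq rfl).trans (congrArg (Prod.mk _) ?_)
    refine (Store.pushAll_append _ _ _).trans ?_
    refine (congrArg (Store.pushAll _) (pushAll_mulPush_pre
      (if decide (Even t) = true then a else b) (altWord a b t)
      { conf Γ a b t [] i m vs out with par := [!decide (Even t)] })).trans ?_
    rw [h1, mulTop_altWord_succ hab t, h2]
    rfl
  exact .head rfl (.head h3 (.head h4 (.refl _ _)))

/-- The search through all levels below the level `l`. -/
theorem reach_level (hab : a ≠ b) {n l D : ℕ} (hn : (wordsBelow Γ a b l).length ≤ n)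
    (hD : leafCost V k l ≤ D) :
    Reach (prog Γ a b k) (l * (2 * n + 3) + D * (wordsBelow Γ a b l).length)
      (some (.down {a, b}), conf Γ a b (-k) [] n 0 [] [])
      (some (.down {a, b}), conf Γ a b (l - k) [] (n - (wordsBelow Γ a b l).length) l
        (vertsText a b k (wordsBelow Γ a b l)) (edgesText Γ a b k (wordsBelow Γ a b l))) := by
  induction l with
  | zero =>
    refine (Reach.refl _ _).congr ?_
    simp [wordsBelow, vertsText, edgesText, edgesOf]
  | succ l ih =>
    rw [wordsBelow_succ, List.length_append] at hn
    have hD' := (leafCost_mono (V := V) (k := k) l.le_succ).trans hD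
    have h1 := ih (by omega) hD'
    have h2 := reach_subtree hab (Γ := Γ) (k := k) (r := []) (m := l) (t := l - k) (by simp)
      (n - (wordsBelow Γ a b (l + 1)).length) (vertsText a b k (wordsBelow Γ a b l))
      (edgesText Γ a b k (wordsBelow Γ a b l)) (D := D) (by simpa using hD')
      (le_add_right le_rfl : _ ≤ _ + 1)
    have e : n - (wordsBelow Γ a b l).length =
        n - (wordsBelow Γ a b (l + 1)).length + (leaves Γ a b l []).length := by
      rw [wordsBelow_succ, List.length_append]
      omega
    rw [e] at h1
    have h3 := (h1.trans h2).trans (reach_lift hab _ _ _ _ _)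
    refine (h3.mono ?_).congr ?_
    · rw [nodes_nil, wordsBelow_succ, List.length_append, mul_add D,
        Nat.succ_mul l (2 * n + 3)]
      omega
    · rw [wordsBelow_succ l, vertsText_append, edgesText_append]
      congr 2
      push_cast
      ring

theorem reach_clearSuf (s : List (V × Finset V)) (T : Store V) :
    Reach (prog Γ a b k) (s.length + 1) (some .clearSuf, { T with suf := s })
      (some .clearPre, { T with suf := [] }) := by
  induction s with
  | nil => exact .head rfl (.refl _ _)
  | cons x s ih => exact .head rfl ih

theorem reach_clearPre (s : List V) (T : Store V) :
    Reach (prog Γ a b k) (s.length + 1) (some .clearPre, { T with pre := s })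
      (some .clearPar, { T with pre := [] }) := by
  induction s with
  | nil => exact .head rfl (.refl _ _)
  | cons x s ih => exact .head rfl ih

theorem reach_flush (s out : List (Symbol V)) :
    Reach (prog Γ a b k) (s.length + 1) (some .flush, { finalStore out with verts := s })
      (none, finalStore (s.reverse ++ out)) := by
  induction s generalizing out with
  | nil => exact .head rfl (.refl _ _)
  | cons x s ih =>
    refine .head rfl ((ih (x :: out)).congr ?_)
    simp

/-- The complete run of the machine, if there are at most `n` suffix words of length less than `l`
and more than `n` of length at most `l`. -/
theorem reach_final (hab : a ≠ b) {n l : ℕ} (hn : (wordsBelow Γ a b l).length ≤ n)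
    (hn' : n < (wordsBelow Γ a b (l + 1)).length) :
    Reach (prog Γ a b k) (timeBound V k l n) (some .init, startStore V n)
      (none, finalStore ((vertsText a b k ((wordsBelow Γ a b (l + 1)).take n)).reverse ++
        edgesText Γ a b k ((wordsBelow Γ a b (l + 1)).take n))) := by
  obtain ⟨i, rfl⟩ := Nat.exists_eq_add_of_le hn
  have hi : i < (leaves Γ a b l []).length := by
    rw [wordsBelow_succ, List.length_append] at hn'
    omega
  have ht : (wordsBelow Γ a b (l + 1)).take ((wordsBelow Γ a b l).length + i) =
      wordsBelow Γ a b l ++ (leaves Γ a b l []).take i := by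
    rw [wordsBelow_succ, List.take_length_add_append]
  have hw : ∀ r ∈ (wordsBelow Γ a b (l + 1)).take ((wordsBelow Γ a b l).length + i),
      r.length ≤ l := fun r hr =>
    Nat.lt_succ_iff.1 (mem_wordsBelow.1 (List.mem_of_mem_take hr)).1
  have hlen := length_vertsText_le (a := a) (b := b) (k := k) hw
  rw [List.length_take, min_eq_left hn'.le] at hlen
  have h1 := (reach_init (Γ := Γ) (a := a) (b := b) (k := k) _).trans
    (reach_level hab hn le_rfl)
  rw [Nat.add_sub_cancel_left] at h1
  obtain ⟨r', hr', h2⟩ := reach_clear hab (Γ := Γ) (k := k) (r := []) (m := l) (t := l - k)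
    (by simp) hi (vertsText a b k (wordsBelow Γ a b l)) (edgesText Γ a b k (wordsBelow Γ a b l))
    (D := leafCost V k l) (by simp)
  rw [← vertsText_append, ← edgesText_append, ← ht] at h2
  have h3 := h1.trans h2
  generalize vertsText a b k (List.take _ _) = vs at h3 hlen ⊢
  generalize edgesText Γ a b k (List.take _ _) = es at h3 ⊢
  have h4 := h3.trans
    (reach_clearSuf (annotate Γ a b r') (conf Γ a b (l - k) r' 0 0 vs es))
  have h5 := h4.trans
    (reach_clearPre (altWord a b (l - k)) (conf Γ a b (l - k) [] 0 0 vs es))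
  have h6 := h5.trans (.head (t := _) rfl (reach_flush vs es))
  refine h6.mono ?_
  simp only [length_annotate, length_altWord, hr', List.length_nil, nodes_nil, timeBound,
    mul_add, add_mul] at hlen ⊢
  omega

end Run

/-! ### The Turing machine -/

section Turing

variable {V : Type} [LinearOrder V] [Fintype V] (Γ : SimpleGraph V) [DecidableRel Γ.Adj] (a b : V)
  (k : ℤ)

/-- The enumerating machine as a multi-stack Turing machine. All its stacks have finite alphabets,
and each step consists of one pop and a bounded number of pushes. -/
noncomputable def machine : Turing.FinTM2 where
  K := Stk
  k₀ := .inp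
  k₁ := .out
  Γ := StkSym V
  Λ := State V
  main := .init
  σ := Option (Σ k, StkSym V k)
  initialState := none
  Γk₀Fin := inferInstanceAs (Fintype (StkSym V .inp))
  m q := (prog Γ a b k q).toStmt

/-- The configuration of the Turing machine with a given state and given stacks. -/
def machineCfg (x : Option (State V) × Store V) : (machine Γ a b k).Cfg :=
  ⟨x.1, none, x.2.get⟩

variable {Γ a b k}

/-- A step of the Turing machine is the execution of an instruction. -/
theorem step_machineCfg (q : State V) (T : Store V) :
    (machine Γ a b k).step (machineCfg Γ a b k (some q, T)) =
      some (machineCfg Γ a b k (exec (prog Γ a b k q) T)) := by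
  refine congrArg some ((stepAux_toStmt (prog Γ a b k q) T.get).trans ?_)
  rw [machineCfg, exec, Store.get_pushAll, Store.get_set]
  rfl

theorem Reach.exists_iterate {t : ℕ} {x y : Option (State V) × Store V}
    (h : Reach (prog Γ a b k) t x y) : ∃ s ≤ t,
      (flip Bind.bind (machine Γ a b k).step)^[s] (some (machineCfg Γ a b k x)) =
        some (machineCfg Γ a b k y) := by
  induction h with
  | refl t x => exact ⟨0, Nat.zero_le _, rfl⟩
  | @step t q T y _ ih =>
    obtain ⟨s, hs, h⟩ := ih
    refine ⟨s + 1, by omega, ?_⟩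
    rw [Function.iterate_succ_apply, ← h]
    exact congrArg _ (step_machineCfg q T)

theorem initList_machine (n : ℕ) :
    Turing.initList (machine Γ a b k) (List.replicate n true) =
      machineCfg Γ a b k (some .init, startStore V n) := by
  refine congrArg (Turing.TM2.Cfg.mk _ _) (funext fun s => ?_)
  cases s <;> rfl

theorem haltList_machine (l : List (Symbol V)) :
    Turing.haltList (machine Γ a b k) l = machineCfg Γ a b k (none, finalStore l) := by
  refine congrArg (Turing.TM2.Cfg.mk _ _) (funext fun s => ?_)
  cases s <;> rfl

theorem unaryEncodeNat_eq_replicate (n : ℕ) :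
    Computability.unaryEncodeNat n = List.replicate n true := by
  induction n with
  | zero => rfl
  | succ n ih => rw [Computability.unaryEncodeNat, ih, List.replicate_succ]

/-- A function is computed by the machine in time `T` if the program leads from the input to the
output in that time. -/
theorem exists_computableInTime (f : ℕ → Listing V) (T : ℕ → ℕ)
    (h : ∀ n, Reach (prog Γ a b k) (T n) (some .init, startStore V n)
      (none, finalStore (encodeListing (f n)))) :
    ∃ M : Turing.TM2ComputableInTime Computability.unaryEncodeNat encodeListing f, M.time = T := by
  have key : ∀ (n : ℕ) (l : List Bool) (l' : List (Symbol V)) (m : ℕ), l = List.replicate n true →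
      l' = encodeListing (f n) → m = T n →
      Nonempty (Turing.TM2OutputsInTime (machine Γ a b k) l (some l') m) := by
    rintro n _ _ _ rfl rfl rfl
    obtain ⟨s, hs, h⟩ := (h n).exists_iterate
    refine ⟨⟨⟨s, ?_⟩, hs⟩⟩
    exact (congrArg (fun x => (flip Bind.bind (machine Γ a b k).step)^[s] (some x))
      (initList_machine n)).trans (h.trans (congrArg some (haltList_machine _).symm))
  have h' : ∀ n, Nonempty (Turing.TM2OutputsInTime (machine Γ a b k)
      (List.map (Equiv.refl Bool).invFun (Computability.unaryEncodeNat n))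
      (some (List.map (Equiv.refl (Symbol V)).invFun (encodeListing (f n))))
      (T (Computability.unaryEncodeNat n).length)) := fun n =>
    key n _ _ _ ((List.map_id _).trans (unaryEncodeNat_eq_replicate n)) (List.map_id _)
      (by rw [unaryEncodeNat_eq_replicate, List.length_replicate])
  exact ⟨{
    tm := machine Γ a b k
    inputAlphabet := Equiv.refl Bool
    outputAlphabet := Equiv.refl (Symbol V)
    time := T
    outputsFun := fun n => (h' n).some }, rfl⟩

end Turing

/-! ### Correctness of the output -/

section Listing

variable {V : Type} [LinearOrder V] {Γ : SimpleGraph V} [DecidableRel Γ.Adj] {a b : V} {k : ℤ}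

theorem accept_iff {t : ℤ} {r : List V} {j : V × V} : accept Γ a b t r j = true ↔
    ((actPair Γ a b t r j).2.length : ℤ) - (actPair Γ a b t r j).1 = r.length - t ∧
      RevShortlex (actPair Γ a b t r j).2 r := by
  simp [accept, lessRev_eq_true_iff]

theorem mem_edgeAt {t : ℤ} {r : List V} {j : V × V} {e : Label V × Label V} :
    e ∈ edgeAt Γ a b t r j ↔ accept Γ a b t r j = true ∧
      e = (label a b t r, label a b (actPair Γ a b t r j).1 (actPair Γ a b t r j).2) := by
  rw [edgeAt]
  split_ifs with h <;> simp [h]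

variable [Fintype V]

variable (Γ a b k) in
/-- The vertices and edges that belong to a list of suffix words. -/
noncomputable def listing (rs : List (List V)) : Listing V where
  verts := rs.map (suffixLabel a b k)
  edges := (edgesOf Γ a b k rs).reverse

variable (Γ a b k) in
theorem encodeListing_listing (rs : List (List V)) :
    encodeListing (listing Γ a b k rs) =
      (vertsText a b k rs).reverse ++ edgesText Γ a b k rs := by
  simp only [encodeListing, listing, vertsText, edgesText, List.reverse_reverse, List.flatMap_map]
  rfl

theorem suffixLabel_mem_horosphere (hab : a ≠ b) (hadj : ¬ Γ.Adj a b) {r : List V}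
    (hr : Good Γ a b r) : evalPair Γ (suffixLabel a b k r) ∈ horosphere Γ a b k :=
  (elt_mem_horosphere hab hadj hr).2 (by ring)

/-- The edges that are written lead from each vertex to its neighbours that are listed earlier. -/
theorem mem_edgesOf {rs : List (List V)} {e : Label V × Label V} :
    e ∈ edgesOf Γ a b k rs ↔ ∃ r ∈ rs, ∃ r', e = (suffixLabel a b k r, suffixLabel a b k r') ∧
      RevShortlex r' r ∧ ∃ j, actPair Γ a b (r.length - k) r j = (r'.length - k, r') := by
  simp only [edgesOf, edgesAt, List.mem_flatMap, letterPairs, Finset.mem_toList,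
    Finset.mem_univ, true_and, mem_edgeAt, accept_iff]
  refine exists_congr fun r => and_congr_right fun hr => ?_
  constructor
  · rintro ⟨j, ⟨h1, h2⟩, rfl⟩
    have h3 : (actPair Γ a b (r.length - k) r j).1 =
        (actPair Γ a b (r.length - k) r j).2.length - k := by omega
    refine ⟨_, ?_, h2, j, Prod.ext h3 rfl⟩
    rw [suffixLabel, suffixLabel, ← h3]
  · rintro ⟨r', rfl, h, j, hj⟩
    refine ⟨j, ?_⟩
    rw [hj]
    exact ⟨⟨by ring, h⟩, rfl⟩

theorem good_actPair {t : ℤ} {r : List V} (hr : Good Γ a b r) (j : V × V) :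
    Good Γ a b (actPair Γ a b t r j).2 :=
  good_act (good_act hr)

/-- The first `n` suffix words give a correct listing: since the words are in shortlex order, each
edge leads from one of its endpoints to an endpoint listed earlier. -/
theorem isRipsListing_listing (hab : a ≠ b) (hadj : ¬ Γ.Adj a b) {n l : ℕ}
    (hn : n ≤ (wordsBelow Γ a b l).length) :
    IsRipsListing Γ a b k n (listing Γ a b k ((wordsBelow Γ a b l).take n)) := by
  set rs := (wordsBelow Γ a b l).take n with hrs
  have hgood : ∀ r ∈ rs, Good Γ a b r := fun r hr =>
    (mem_wordsBelow.1 (List.mem_of_mem_take hr)).2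
  have hdown : ∀ r ∈ rs, ∀ r', Good Γ a b r' → RevShortlex r' r → r' ∈ rs := by
    intro r hr r' hr' h
    refine mem_take_of_pairwise (fun _ _ h => h.asymm) (pairwise_wordsBelow l) hr ?_ h
    exact mem_wordsBelow.2
      ⟨h.length_le.trans_lt (mem_wordsBelow.1 (List.mem_of_mem_take hr)).1, hr'⟩
  have hnodup : rs.Nodup :=
    ((pairwise_wordsBelow l).sublist (List.take_sublist _ _)).imp fun h => h.ne
  have hedge : ∀ r ∈ rs, ∀ r' ∈ rs, (suffixLabel a b k r, suffixLabel a b k r') ∈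
      edgesOf Γ a b k rs ↔ RevShortlex r' r ∧
        wordDist Γ (evalPair Γ (suffixLabel a b k r)) (evalPair Γ (suffixLabel a b k r')) ≤ 2 := by
    intro r hr r' hr'
    rw [mem_edgesOf]
    constructor
    · rintro ⟨s, -, s', he, h, j, hj⟩
      obtain rfl := suffixLabel_injective (Prod.ext_iff.1 he).1
      obtain rfl := suffixLabel_injective (Prod.ext_iff.1 he).2
      exact ⟨h, (wordDist_le_two_iff hab hadj (hgood _ hr) (hgood _ hr') (by ring) h.ne.symm).2
        ⟨j.1, j.2, hj⟩⟩
    · rintro ⟨h, hd⟩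
      obtain ⟨c, d, hcd⟩ := (wordDist_le_two_iff hab hadj (hgood _ hr) (hgood _ hr') (by ring)
        h.ne.symm).1 hd
      exact ⟨r, hr, r', rfl, h, (c, d), hcd⟩
  refine ⟨?_, ?_, ?_, ?_, ?_, ?_, ?_⟩
  · rw [listing, List.length_map, hrs, List.length_take, min_eq_left hn]
  · rw [listing, List.map_map]
    refine List.Nodup.map_on ?_ hnodup
    intro r hr r' hr' h
    exact (elt_injective hab hadj (hgood r hr) (hgood r' hr') h).2
  · rintro _ hx
    obtain ⟨r, hr, rfl⟩ := List.mem_map.1 hx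
    exact (hgood r hr).isPrefixSuffix hab hadj _
  · rintro _ hx
    obtain ⟨r, hr, rfl⟩ := List.mem_map.1 hx
    exact suffixLabel_mem_horosphere hab hadj (hgood r hr)
  · rintro _ hx y hy hy' hlt
    obtain ⟨r, hr, rfl⟩ := List.mem_map.1 hx
    obtain ⟨t, r', hr', rfl⟩ := hy.exists_eq_label hab hadj
    have ht := (elt_mem_horosphere hab hadj hr').1 hy'
    obtain rfl : t = r'.length - k := by omega
    have hlt' : r'.length < r.length := by simpa [suffixLabel, label] using hlt
    exact List.mem_map_of_mem (hdown r hr r' hr' (.of_length_lt hlt'))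
  · intro e he
    obtain ⟨r, hr, r', rfl, h, j, hj⟩ := mem_edgesOf.1 (List.mem_reverse.1 he)
    have hr' : Good Γ a b r' := by
      have := good_actPair (t := r.length - k) (hgood r hr) j
      rwa [hj] at this
    exact ⟨List.mem_map_of_mem hr, List.mem_map_of_mem (hdown r hr r' hr' h)⟩
  · rintro _ hx _ hy
    obtain ⟨r, hr, rfl⟩ := List.mem_map.1 hx
    obtain ⟨r', hr', rfl⟩ := List.mem_map.1 hy
    have hsymm : wordDist Γ (evalPair Γ (suffixLabel a b k r'))
        (evalPair Γ (suffixLabel a b k r)) = wordDist Γ (evalPair Γ (suffixLabel a b k r))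
        (evalPair Γ (suffixLabel a b k r')) := by
      rw [wordDist, ← (system Γ).length_inv, mul_inv_rev, inv_inv, wordDist]
    simp only [listing, List.mem_reverse]
    rw [hedge r hr r' hr', hedge r' hr' r hr, hsymm, ← or_and_right]
    constructor
    · rintro ⟨h, hd⟩
      refine ⟨suffixLabel_mem_horosphere hab hadj (hgood r hr),
        suffixLabel_mem_horosphere hab hadj (hgood r' hr'), fun he => ?_, hd⟩
      have he' := (elt_injective hab hadj (hgood r hr) (hgood r' hr') (Subtype.ext_iff.1 he)).2
      rcases h with h | h
      · exact h.ne he'.symm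
      · exact h.ne he'
    · rintro ⟨hx, hy, hne, hd⟩
      refine ⟨RevShortlex.of_ne fun h => hne ?_, hd⟩
      subst h
      rfl

end Listing

/-! ### The running time -/

section Asymptotics

variable {V : Type} [Fintype V]

theorem leafCost_mul_le (k : ℤ) {x : ℕ} (hx : 0 < x) :
    leafCost V k (6 * x) ≤ leafCost V k 6 * x := by
  have h : k.natAbs ≤ k.natAbs * x := Nat.le_mul_of_pos_right _ hx
  calc leafCost V k (6 * x)
      ≤ ((letterPairs V).length + 1) *
          (15 * (6 * x + (6 * x + k.natAbs * x)) + 40 * x) + 2 * x := by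
        unfold leafCost
        gcongr <;> omega
    _ = leafCost V k 6 * x := by unfold leafCost; ring

theorem timeBound_le (k : ℤ) {n x l : ℕ} (hn : 0 < n) (hx : 0 < x) (hl : l ≤ 6 * x) :
    timeBound V k l n ≤ (leafCost V k 6 + 2 * k.natAbs + 65) * (n * x) := by
  have h1 : leafCost V k l * n ≤ leafCost V k 6 * x * n :=
    Nat.mul_le_mul_right _ ((leafCost_mono hl).trans (leafCost_mul_le k hx))
  have h2 : l * (2 * n + 3) ≤ 6 * x * (2 * n + 3 * n) := by gcongr; omega
  have h3 : n * (2 * l + k.natAbs + 2) ≤ n * (2 * (6 * x) + k.natAbs * x + 2 * x) := by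
    have h : k.natAbs ≤ k.natAbs * x := Nat.le_mul_of_pos_right _ hx
    gcongr
    omega
  have h4 : n ≤ n * x := Nat.le_mul_of_pos_right _ hx
  have h5 : x ≤ n * x := Nat.le_mul_of_pos_left _ hn
  have h6 : 0 < n * x := Nat.mul_pos hn hx
  have h7 : k.natAbs ≤ k.natAbs * (n * x) := Nat.le_mul_of_pos_right _ h6
  unfold timeBound
  nlinarith

variable [LinearOrder V] {Γ : SimpleGraph V} [DecidableRel Γ.Adj] {a b : V}

/-- The level at which the search ends is logarithmic in the number of vertices. -/
theorem level_le (hΓ : StandingAssumptions Γ) (hab : a ≠ b) (hadj : ¬ Γ.Adj a b) {n l : ℕ}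
    (hl : (wordsBelow Γ a b l).length ≤ n) : l ≤ 2 * Nat.log 2 n + 4 := by
  cases l with
  | zero => omega
  | succ l =>
    rw [wordsBelow_succ, List.length_append] at hl
    have h := (two_pow_le_leaves_nil hΓ hab hadj l).trans ((Nat.le_add_left _ _).trans hl)
    have := Nat.le_log_of_pow_le Nat.one_lt_two h
    omega

theorem isBigO_timeBound (hΓ : StandingAssumptions Γ) (hab : a ≠ b) (hadj : ¬ Γ.Adj a b) (k : ℤ)
    {L : ℕ → ℕ} (hL : ∀ n, (wordsBelow Γ a b (L n)).length ≤ n) :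
    (fun n : ℕ => (timeBound V k (L n) n : ℝ)) =O[atTop] fun n : ℕ => (n : ℝ) * Real.log n := by
  refine IsBigO.of_bound ((leafCost V k 6 + 2 * k.natAbs + 65 : ℕ) / Real.log 2) ?_
  filter_upwards [eventually_ge_atTop 2] with n hn
  -- the level is at most `2 * Nat.log 2 n + 4`, hence at most `6 * Nat.log 2 n`
  have hx : 0 < Nat.log 2 n := Nat.log_pos Nat.one_lt_two hn
  have h1 := level_le hΓ hab hadj (hL n)
  have h2 := timeBound_le (V := V) k (n := n) (by omega) hx (l := L n) (by omega)
  have h3 : (Nat.log 2 n : ℝ) ≤ Real.log n / Real.log 2 := by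
    have := Real.natLog_le_logb n 2
    rwa [Real.logb] at this
  have h4 : 0 ≤ Real.log n := Real.log_natCast_nonneg n
  rw [Real.norm_of_nonneg (Nat.cast_nonneg _), Real.norm_of_nonneg (by positivity)]
  calc (timeBound V k (L n) n : ℝ)
      ≤ ((leafCost V k 6 + 2 * k.natAbs + 65 : ℕ) : ℝ) * (n * Nat.log 2 n) := by exact_mod_cast h2
    _ ≤ ((leafCost V k 6 + 2 * k.natAbs + 65 : ℕ) : ℝ) * (n * (Real.log n / Real.log 2)) := by
        gcongr
    _ = _ := by ring

end Asymptotics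

end RACG

/-- For fixed `Γ`, `a`, `b`, `k` there is a multi-stack Turing machine which on input `n` (in unary,
so that the length of the input is `n`) writes down `n` vertices of the `2`-Rips graph on the
horosphere `b_γ⁻¹(k)`, `γ = (ab)^∞`, and the edges between them, in `O(n log n)` steps. -/
theorem mainTheorem1 {V : Type} [Fintype V] [LinearOrder V] (Γ : SimpleGraph V)
    (hΓ : RACG.StandingAssumptions Γ) (a b : V) (hab : a ≠ b) (hadj : ¬ Γ.Adj a b) (k : ℤ) :
    ∃ (f : ℕ → RACG.Listing V)
      (M : Turing.TM2ComputableInTime Computability.unaryEncodeNat RACG.encodeListing f),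
      (∀ n, RACG.IsRipsListing Γ a b k n (f n)) ∧
      (fun n : ℕ => (M.time n : ℝ)) =O[atTop] (fun n : ℕ => (n : ℝ) * Real.log n) := by
  classical
  -- `L n` is the length of the suffix words at which `n` vertices are reached
  choose L hL using fun n => (⟨_, Nat.find_spec (RACG.exists_lt_wordsBelow hΓ hab hadj n),
    fun m hm => not_lt.1 (Nat.find_min (RACG.exists_lt_wordsBelow hΓ hab hadj n) hm)⟩ :
    ∃ l, n < (RACG.wordsBelow Γ a b (l + 1)).length ∧
      ∀ m < l, (RACG.wordsBelow Γ a b (m + 1)).length ≤ n)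
  have hL' : ∀ n, (RACG.wordsBelow Γ a b (L n)).length ≤ n := by
    intro n
    cases h : L n with
    | zero => simp [RACG.wordsBelow]
    | succ m => exact (hL n).2 m (by omega)
  obtain ⟨M, hM⟩ := RACG.exists_computableInTime (Γ := Γ) (a := a) (b := b) (k := k)
    (fun n => RACG.listing Γ a b k ((RACG.wordsBelow Γ a b (L n + 1)).take n))
    (fun n => RACG.timeBound V k (L n) n) fun n => by
      rw [RACG.encodeListing_listing]
      exact RACG.reach_final hab (hL' n) (hL n).1
  refine ⟨_, M, fun n => RACG.isRipsListing_listing hab hadj (hL n).1.le, ?_⟩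
  rw [hM]
  exact RACG.isBigO_timeBound hΓ hab hadj k hL'
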